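/- Let $d\ge 1$, let $V:\mathbb R^d\to\mathbb R$ be such that $\mu(dx)=e^{-V(x)}dx$ is a probability measure on $\mathbb R^d$, and let $\nu$ be a probability measure on $\mathbb R^d$. Put $$p_\nu(x)=\int e^{-V(x-z)}\,\nu(dz),\qquad \nu_x(dz)=\frac{e^{-V(x-z)}}{p_\nu(x)}\,\nu(dz),\qquad x\in\mathbb R^d .$$ For a positive function $\phi$ on $\mathbb R^d$ and $r>0$ let $\varphi_\phi(r)=\sup\{s>0:\inf_{|x|\le s}\phi\ge 1/r\}\in[0,\infty]$ (with $\sup\emptyset=0$), $$\beta_\phi(r)=\mu\big(|x|\ge\tfrac12\varphi_\phi(r)\big)+\nu\big(|x|\ge\tfrac12\varphi_\phi(r)\big),\qquad \beta_\phi^{-1}(s)=\inf\{r>0:\beta_\phi(r)\le s\},\quad s>0 .$$ A probability measure $m$ satisfies the weak Poincaré inequality with a function $\alpha:(0,\infty)\to[0,\infty)$ if $\alpha$ is decreasing (not necessarily strictly) and $$m(f^2)\le\alpha(r)\,m(|\nabla f|^2)+r\sup_{x,y}|f(x)-f(y)|^2$$ for all $r>0$ and all $f\in C_b^1(\mathbb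 R^d)$ (bounded, with bounded continuous gradient) with $m(f)=0$. **(a)** Let $V\in C^1(\mathbb R^d)$ and $R_0>0$. Suppose that $x\mapsto\int|\nabla V(x-z)|e^{-V(x-z)}\nu(dz)$ is bounded on every ball, that $$h(x):=\frac1{|x|}\int\langle x,\nabla V(x-z)\rangle\,\nu_x(dz)$$ is continuous on $\{|x|\ge R_0\}$, and that $\psi(s):=\inf_{|x|=s}h(x)>0$ for all $s\ge R_0$. Then for every $\sigma>0$ there are a continuous function $\phi:\mathbb R^d\to(0,\infty)$ with $$\phi(x)=\frac{h(x)}{(1+\sigma)\,p_\sigma(|x|)},\quad |x|\ge R_0,\qquad p_\sigma(r):=\frac{\int_{R_0}^r s^{1-d}\exp\big[\frac{\sigma}{\sigma+1}\int_{R_0}^s\psi(u)du\big]ds+1}{r^{1-d}\exp\big[\frac{\sigma}{\sigma+1}\int_{R_0}^r\psi(u)du\big]},\quad r\ge R_0,$$ and a constant $c>0$ such that $\beta_\phi^{-1}<\infty$ on $(0,\infty)$ and $\mu*\nu$ satisfies the weak Poincaré inequality with $\alpha(r)=c\,\beta_\phi^{-1}(r)$. **(b)** Let $V\in C^2(\mathbb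 R^d)$, $\delta\in(0,1)$ and $R_0>0$. Suppose that $x\mapsto\int\big(|\nabla V|+|\nabla V|^2+|\Delta V|\big)(x-z)\,e^{-V(x-z)}\nu(dz)$ is bounded on every ball, and that $$g(x):=\int\big(\delta|\nabla V(x-z)|^2-\Delta V(x-z)\big)\,\nu_x(dz)$$ is continuous and positive on $\{|x|\ge R_0\}$. Then there are a continuous function $\phi:\mathbb R^d\to(0,\infty)$ with $\phi(x)=(1-\delta)g(x)$ for $|x|\ge R_0$ and a constant $c>0$ such that $\beta_\phi^{-1}<\infty$ on $(0,\infty)$ and $\mu*\nu$ satisfies the weak Poincaré inequality with $\alpha(r)=c\,\beta_\phi^{-1}(r)$. -/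

import Mathlib

open MeasureTheory Set
open scoped NNReal Laplacian InnerProductSpace

noncomputable section

/-- Oscillation `sup_{x,y} |f x - f y|` (used for bounded `f`). -/
def oscFun {E : Type*} (f : E → ℝ) : ℝ :=
  sSup (range fun p : E × E => |f p.1 - f p.2|)

/-- The probability measure `m` on `ℝ^d` satisfies the weak Poincaré inequality with the function
`α` on `(0, ∞)`: `α` is nonnegative and decreasing there and, for all `r > 0` and all `f ∈ C_b^1`
(bounded `C^1` functions with bounded gradient) with `m(f) = 0`,
`m(f ^ 2) ≤ α(r) m(|∇ f| ^ 2) + r Osc(f) ^ 2`. -/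
structure WeakPoincare {d : ℕ} (m : Measure (EuclideanSpace ℝ (Fin d))) (α : ℝ → ℝ) : Prop where
  nonneg : ∀ r, 0 < r → 0 ≤ α r
  antitone : AntitoneOn α (Ioi 0)
  ineq : ∀ f : EuclideanSpace ℝ (Fin d) → ℝ, ContDiff ℝ 1 f →
    (∃ C, ∀ x, |f x| ≤ C) → (∃ C, ∀ x, ‖gradient f x‖ ≤ C) → ∫ x, f x ∂m = 0 →
    ∀ r : ℝ, 0 < r →
      ∫ x, f x ^ 2 ∂m ≤ α r * ∫ x, ‖gradient f x‖ ^ 2 ∂m + r * oscFun f ^ 2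

variable {d : ℕ}

/-- The measure `e^{-V} dx`. -/
def gibbs (V : EuclideanSpace ℝ (Fin d) → ℝ) : Measure (EuclideanSpace ℝ (Fin d)) :=
  volume.withDensity fun x => ENNReal.ofReal (Real.exp (-V x))

/-- `p_ν(x) = ∫ e^{-V(x-z)} ν(dz)`, the density of the convolution. -/
def convDensity (V : EuclideanSpace ℝ (Fin d) → ℝ) (ν : Measure (EuclideanSpace ℝ (Fin d)))
    (x : EuclideanSpace ℝ (Fin d)) : ℝ :=
  ∫ z, Real.exp (-V (x - z)) ∂ν

/-- `ν_x(dz) = p_ν(x)⁻¹ e^{-V(x-z)} ν(dz)`. -/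
def tiltedNu (V : EuclideanSpace ℝ (Fin d) → ℝ) (ν : Measure (EuclideanSpace ℝ (Fin d)))
    (x : EuclideanSpace ℝ (Fin d)) : Measure (EuclideanSpace ℝ (Fin d)) :=
  ν.withDensity fun z => ENNReal.ofReal (Real.exp (-V (x - z)) / convDensity V ν x)

/-- `∫ ⟨x, ∇V(x-z)⟩ ν_x(dz) / |x|`. -/
def radialDrift (V : EuclideanSpace ℝ (Fin d) → ℝ) (ν : Measure (EuclideanSpace ℝ (Fin d)))
    (x : EuclideanSpace ℝ (Fin d)) : ℝ :=
  (∫ z, inner ℝ x (gradient V (x - z)) ∂(tiltedNu V ν x)) / ‖x‖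

/-- `ψ(s)`, the infimum of the radial drift over the sphere of radius `s`. -/
def minDrift (V : EuclideanSpace ℝ (Fin d) → ℝ) (ν : Measure (EuclideanSpace ℝ (Fin d)))
    (s : ℝ) : ℝ :=
  sInf (radialDrift V ν '' Metric.sphere 0 s)

/-- `r^{1-d} exp (σ / (σ + 1) ∫_{R₀}^r ψ)`. -/
def pWeight (d : ℕ) (R₀ σ : ℝ) (ψ : ℝ → ℝ) (r : ℝ) : ℝ :=
  r ^ (1 - (d : ℤ)) * Real.exp (σ / (σ + 1) * ∫ u in R₀..r, ψ u)

/-- `p_σ(r)`. -/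
def pSigma (d : ℕ) (R₀ σ : ℝ) (ψ : ℝ → ℝ) (r : ℝ) : ℝ :=
  ((∫ s in R₀..r, pWeight d R₀ σ ψ s) + 1) / pWeight d R₀ σ ψ r

/-- `∫ (δ |∇V(x-z)|² - ΔV(x-z)) ν_x(dz)`. -/
def lyapunovIntegral (δ : ℝ) (V : EuclideanSpace ℝ (Fin d) → ℝ)
    (ν : Measure (EuclideanSpace ℝ (Fin d))) (x : EuclideanSpace ℝ (Fin d)) : ℝ :=
  ∫ z, (δ * ‖gradient V (x - z)‖ ^ 2 - (Δ V) (x - z)) ∂(tiltedNu V ν x)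

/-- `x ↦ ∫ g(x-z) e^{-V(x-z)} ν(dz)` is bounded on every ball, for a nonnegative `g`. -/
def LocallyBoundedMix (V : EuclideanSpace ℝ (Fin d) → ℝ)
    (ν : Measure (EuclideanSpace ℝ (Fin d))) (g : EuclideanSpace ℝ (Fin d) → ℝ) : Prop :=
  ∀ R : ℝ, ∃ C : ℝ≥0, ∀ x : EuclideanSpace ℝ (Fin d), ‖x‖ ≤ R →
    ∫⁻ z, ENNReal.ofReal (g (x - z) * Real.exp (-V (x - z))) ∂ν ≤ C

/-- `φ_ϕ(r) = sup {s > 0 : inf_{|x| ≤ s} ϕ ≥ 1/r} ∈ [0, ∞]`, with `sup ∅ = 0`. -/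
def levelRadius (φ : EuclideanSpace ℝ (Fin d) → ℝ) (r : ℝ) : ENNReal :=
  sSup (ENNReal.ofReal '' {s : ℝ | 0 < s ∧ 1 / r ≤ sInf (φ '' Metric.closedBall 0 s)})

/-- `β_ϕ(r) = μ(|x| ≥ φ_ϕ(r)/2) + ν(|x| ≥ φ_ϕ(r)/2)`. -/
def tailBeta (μ ν : Measure (EuclideanSpace ℝ (Fin d))) (φ : EuclideanSpace ℝ (Fin d) → ℝ)
    (r : ℝ) : ℝ :=
  μ.real {x | levelRadius φ r / 2 ≤ ‖x‖ₑ} + ν.real {x | levelRadius φ r / 2 ≤ ‖x‖ₑ}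

/-- The generalized inverse `β_ϕ⁻¹(s) = inf {r > 0 : β_ϕ(r) ≤ s}`. -/
def tailBetaInv (μ ν : Measure (EuclideanSpace ℝ (Fin d))) (φ : EuclideanSpace ℝ (Fin d) → ℝ)
    (s : ℝ) : ℝ :=
  sInf {r : ℝ | 0 < r ∧ tailBeta μ ν φ r ≤ s}

/-- `μ * ν` satisfies the weak Poincaré inequality with `α = c β_ϕ⁻¹` for some constant `c > 0`.
The first conjunct says that `β_ϕ⁻¹` is finite on `(0, ∞)`. -/
def WeakPoincareBeta (μ ν : Measure (EuclideanSpace ℝ (Fin d)))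
    (φ : EuclideanSpace ℝ (Fin d) → ℝ) : Prop :=
  (∀ s : ℝ, 0 < s → ∃ r : ℝ, 0 < r ∧ tailBeta μ ν φ r ≤ s) ∧
    ∃ c : ℝ, 0 < c ∧ WeakPoincare (Measure.conv μ ν) fun r => c * tailBetaInv μ ν φ r

end

open Filter Topology

section

variable {d : ℕ}

/-! Write m = μ∗ν, with density p_ν. Everything rests on a Hardy-type inequality m(φF²) ≤ m(|∇F|²)
for compactly supported C¹ functions F vanishing on a fixed ball. Since m is a mixture of translates
of μ, it suffices to integrate by parts in x against e^{-V(x-z)} for each fixed z and then integrate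
in ν(dz); Fubini and the normalisation in ν_x turn the derivatives of V into the averages h and g
(`lintegral_le_of_forall_fiber`). No functional inequality for μ itself is needed.

In (a) the test field is x/(|x| p_σ(|x|)). With κ = σ/(σ+1), p_σ is built so that the divergence of
this field plus its squared length equals κψ/p_σ. Young's inequality absorbs the cross term into
|∇F|², and h/p_σ - κψ/p_σ ≥ h/((1+σ)p_σ) = φ because ψ ≤ h (`neg_integral_radial_le`,
`lyapunov_of_radialDrift`). In (b) the test field is a multiple of ∇V(x-z) itself, and completing
the square produces the factor 1-δ (`integral_sq_mul_lyapunov_le`).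

A cutoff and a Poincaré inequality on a ball, valid because p_ν is locally bounded above and away
from zero, extend the estimate to m(φ(f-c)²) ≤ C m(|∇f|²) for every bounded C¹ function f, with c a
value of f (`exists_weighted_poincare`). Finally m((f-c)²) is split at the radius φ_φ(t): inside it
φ ≥ 1/t, so the weighted inequality applies, while outside it |f-c| is at most the oscillation and
the mass is at most β_φ(t). Taking the infimum over t with β_φ(t) ≤ r gives α = Cβ_φ⁻¹
(`weakPoincareBeta_of_weighted`). -/

theorem norm_gradient_eq_norm_fderiv {E : Type*} [NormedAddCommGroup E] [InnerProductSpace ℝ E]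
    [CompleteSpace E] (f : E → ℝ) (x : E) : ‖gradient f x‖ = ‖fderiv ℝ f x‖ := by
  simp [gradient]

/-! ### From a weighted Poincaré inequality to the weak Poincaré inequality -/

theorem abs_sub_le_oscFun {E : Type*} {f : E → ℝ} (hf : ∃ C, ∀ x, |f x| ≤ C) (x y : E) :
    |f x - f y| ≤ oscFun f := by
  obtain ⟨C, hC⟩ := hf
  refine le_csSup ⟨C + C, ?_⟩ ⟨(x, y), rfl⟩
  rintro _ ⟨p, rfl⟩
  exact (abs_sub _ _).trans (add_le_add (hC _) (hC _))

theorem one_div_le_of_enorm_lt_levelRadius {φ : EuclideanSpace ℝ (Fin d) → ℝ} (hpos : ∀ x, 0 < φ x)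
    {r : ℝ} {x : EuclideanSpace ℝ (Fin d)} (hx : ‖x‖ₑ < levelRadius φ r) : 1 / r ≤ φ x := by
  obtain ⟨_, ⟨s, ⟨hs, hs'⟩, rfl⟩, hlt⟩ := lt_sSup_iff.1 hx
  refine hs'.trans (csInf_le ⟨0, ?_⟩ ⟨x, ?_, rfl⟩)
  · rintro _ ⟨y, -, rfl⟩
    exact (hpos y).le
  · rw [← ofReal_norm] at hlt
    simpa using (ENNReal.ofReal_lt_ofReal_iff hs).1 hlt |>.le

/-- If a sum has norm at least ρ, one summand has norm at least ρ/2; this is the origin of the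
factor 1/2 in β. -/
theorem conv_tail_le (μ ν : Measure (EuclideanSpace ℝ (Fin d))) [IsProbabilityMeasure μ]
    [IsProbabilityMeasure ν] (ρ : ENNReal) :
    (μ.conv ν).real {x | ρ ≤ ‖x‖ₑ} ≤ μ.real {x | ρ / 2 ≤ ‖x‖ₑ} + ν.real {x | ρ / 2 ≤ ‖x‖ₑ} := by
  have hmeas : ∀ t : ENNReal, MeasurableSet {x : EuclideanSpace ℝ (Fin d) | t ≤ ‖x‖ₑ} :=
    fun t => measurableSet_le measurable_const measurable_enorm
  have hsub : (fun p : EuclideanSpace ℝ (Fin d) × EuclideanSpace ℝ (Fin d) => p.1 + p.2) ⁻¹'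
      {x | ρ ≤ ‖x‖ₑ} ⊆ {x | ρ / 2 ≤ ‖x‖ₑ} ×ˢ univ ∪ univ ×ˢ {x | ρ / 2 ≤ ‖x‖ₑ} := by
    rintro ⟨x, y⟩ h
    simp only [mem_preimage, mem_ofPred_eq, mem_union, mem_prod, mem_univ, and_true, true_and] at h ⊢
    by_contra! hc
    have h1 := ENNReal.add_lt_add hc.1 hc.2
    rw [ENNReal.add_halves] at h1
    exact absurd (h.trans (enorm_add_le x y)) (not_le.2 h1)
  rw [measureReal_def, Measure.conv, Measure.map_apply measurable_add (hmeas ρ), ← measureReal_def]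
  refine (measureReal_mono hsub).trans ((measureReal_union_le _ _).trans ?_)
  simp [measureReal_prod_prod]

/-- A continuous positive φ is bounded below on each ball, so the level radius exceeds any bound
once r is large, and the tails of two probability measures vanish at infinity. -/
theorem exists_tailBeta_le {μ ν : Measure (EuclideanSpace ℝ (Fin d))} [IsProbabilityMeasure μ]
    [IsProbabilityMeasure ν] {φ : EuclideanSpace ℝ (Fin d) → ℝ} (hφ : Continuous φ)
    (hpos : ∀ x, 0 < φ x) {s : ℝ} (hs : 0 < s) : ∃ r : ℝ, 0 < r ∧ tailBeta μ ν φ r ≤ s := by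
  have htail : ∀ m : Measure (EuclideanSpace ℝ (Fin d)), IsProbabilityMeasure m →
      Tendsto (fun n : ℕ => m.real {x | (n : ENNReal) ≤ ‖x‖ₑ}) atTop (𝓝 0) := by
    intro m _
    have h1 := tendsto_measure_iInter_atTop (μ := m)
      (s := fun n : ℕ => {x : EuclideanSpace ℝ (Fin d) | (n : ENNReal) ≤ ‖x‖ₑ})
      (fun n => (measurableSet_le measurable_const measurable_enorm).nullMeasurableSet)
      (fun a b hab x (hx : (b : ENNReal) ≤ ‖x‖ₑ) =>
        show (a : ENNReal) ≤ ‖x‖ₑ from le_trans (by exact_mod_cast hab) hx) ⟨0, measure_ne_top _ _⟩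
    have h2 : (⋂ n : ℕ, {x : EuclideanSpace ℝ (Fin d) | (n : ENNReal) ≤ ‖x‖ₑ}) = ∅ := by
      ext x
      simp only [mem_iInter, mem_ofPred_eq, mem_empty_iff_false, iff_false, not_forall, not_le]
      exact ENNReal.exists_nat_gt enorm_ne_top
    rw [h2, measure_empty] at h1
    have h3 := (ENNReal.tendsto_toReal ENNReal.zero_ne_top).comp h1
    rwa [ENNReal.toReal_zero] at h3
  have hsum := (htail μ inferInstance).add (htail ν inferInstance)
  rw [add_zero] at hsum
  obtain ⟨n, hn⟩ := (hsum.eventually (gt_mem_nhds hs)).exists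
  -- Half the level radius must reach n; the extra 1 keeps the radius positive when n = 0.
  obtain ⟨x₀, -, hx₀⟩ := (isCompact_closedBall (0 : EuclideanSpace ℝ (Fin d))
    (2 * n + 1)).exists_isMinOn ⟨0, by simp; positivity⟩ hφ.continuousOn
  refine ⟨1 / φ x₀, one_div_pos.2 (hpos x₀), le_trans ?_ hn.le⟩
  have hlev : (n : ENNReal) ≤ levelRadius φ (1 / φ x₀) / 2 := by
    have h1 : ENNReal.ofReal (2 * n + 1) ≤ levelRadius φ (1 / φ x₀) := by
      refine le_sSup ⟨_, ⟨by positivity, ?_⟩, rfl⟩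
      rw [one_div_one_div]
      refine le_csInf ⟨_, ⟨0, by simp; positivity, rfl⟩⟩ ?_
      rintro _ ⟨y, hy, rfl⟩
      exact hx₀ hy
    rw [ENNReal.le_div_iff_mul_le (by simp) (by simp)]
    refine le_trans ?_ h1
    rw [← ENNReal.ofReal_natCast, ← ENNReal.ofReal_ofNat 2, ← ENNReal.ofReal_mul (by positivity)]
    exact ENNReal.ofReal_le_ofReal (by linarith)
  exact add_le_add (measureReal_mono fun x hx => le_trans hlev hx)
    (measureReal_mono fun x hx => le_trans hlev hx)

theorem tailBetaInv_nonneg (μ ν : Measure (EuclideanSpace ℝ (Fin d)))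
    (φ : EuclideanSpace ℝ (Fin d) → ℝ) (s : ℝ) : 0 ≤ tailBetaInv μ ν φ s :=
  Real.sInf_nonneg fun _ hr => hr.1.le

/-- Split at the level radius of t. Centring at a value of f, rather than at a mean, is what bounds
|f - f y| by the oscillation outside. -/
theorem integral_sq_le_of_weighted {μ ν : Measure (EuclideanSpace ℝ (Fin d))}
    [IsProbabilityMeasure μ] [IsProbabilityMeasure ν] {φ f : EuclideanSpace ℝ (Fin d) → ℝ}
    (hpos : ∀ x, 0 < φ x) (hf : ContDiff ℝ 1 f) (hb : ∃ C, ∀ x, |f x| ≤ C)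
    (hb' : ∃ C, ∀ x, ‖gradient f x‖ ≤ C)
    (hmean : ∫ x, f x ∂(μ.conv ν) = 0) {C : ℝ} (hC : 0 ≤ C) (y : EuclideanSpace ℝ (Fin d))
    (h : ∫⁻ x, ENNReal.ofReal (φ x * (f x - f y) ^ 2) ∂(μ.conv ν) ≤
      ENNReal.ofReal C * ∫⁻ x, ENNReal.ofReal (‖gradient f x‖ ^ 2) ∂(μ.conv ν))
    {t : ℝ} (ht : 0 < t) :
    ∫ x, f x ^ 2 ∂(μ.conv ν) ≤
      t * (C * ∫ x, ‖gradient f x‖ ^ 2 ∂(μ.conv ν)) + tailBeta μ ν φ t * oscFun f ^ 2 := by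
  obtain ⟨K, hK⟩ := hb
  obtain ⟨K', hK'⟩ := hb'
  set m := μ.conv ν with hm
  have hgc : Continuous fun x => ‖gradient f x‖ ^ 2 := by
    simp only [norm_gradient_eq_norm_fderiv]
    exact ((hf.continuous_fderiv one_ne_zero).norm.pow 2)
  have hgi : Integrable (fun x => ‖gradient f x‖ ^ 2) m := by
    refine Integrable.of_bound hgc.aestronglyMeasurable (K' ^ 2) (.of_forall fun x => ?_)
    rw [Real.norm_of_nonneg (by positivity)]
    exact pow_le_pow_left₀ (norm_nonneg _) (hK' x) 2
  have hfi : Integrable f m :=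
    Integrable.of_bound hf.continuous.aestronglyMeasurable K (.of_forall hK)
  have hf2i : Integrable (fun x => f x ^ 2) m := by
    refine Integrable.of_bound (hf.continuous.pow 2).aestronglyMeasurable (K ^ 2)
      (.of_forall fun x => ?_)
    rw [Real.norm_of_nonneg (by positivity), ← sq_abs]
    exact pow_le_pow_left₀ (abs_nonneg _) (hK x) 2
  set c := f y
  -- As f has mean zero, replacing f by f - c can only increase the second moment.
  have hsq : ∫ x, (f x - c) ^ 2 ∂m = ∫ x, f x ^ 2 ∂m + c ^ 2 := by
    have : ∀ x, (f x - c) ^ 2 = f x ^ 2 - 2 * c * f x + c ^ 2 := fun x => by ring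
    simp only [this]
    rw [integral_add (f := fun x => f x ^ 2 - 2 * c * f x) (hf2i.sub (hfi.const_mul _))
        (integrable_const _), integral_sub hf2i (hfi.const_mul _), integral_const_mul, hmean]
    simp
  have hgci : Integrable (fun x => (f x - c) ^ 2) m := by
    have : (fun x => (f x - c) ^ 2) = fun x => f x ^ 2 - 2 * c * f x + c ^ 2 := by
      ext x; ring
    rw [this]
    exact (hf2i.sub (hfi.const_mul _)).add (integrable_const _)
  set S := {x : EuclideanSpace ℝ (Fin d) | levelRadius φ t ≤ ‖x‖ₑ} with hS
  have hSm : MeasurableSet S := measurableSet_le measurable_const measurable_enorm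
  have hE0 : 0 ≤ ∫ x, ‖gradient f x‖ ^ 2 ∂m := integral_nonneg fun x => by positivity
  have h1 : ∫ x in S, (f x - c) ^ 2 ∂m ≤ m.real S * oscFun f ^ 2 := by
    have := setIntegral_mono_on (μ := m) (s := S) hgci.integrableOn
      (integrable_const (oscFun f ^ 2)) hSm fun x _ => by
        rw [← sq_abs]
        exact pow_le_pow_left₀ (abs_nonneg _) (abs_sub_le_oscFun ⟨K, hK⟩ x y) 2
    simpa using this
  have h2 : ∫ x in Sᶜ, (f x - c) ^ 2 ∂m ≤ t * (C * ∫ x, ‖gradient f x‖ ^ 2 ∂m) := by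
    refine (ENNReal.ofReal_le_ofReal_iff (by positivity)).1 ?_
    rw [ofReal_integral_eq_lintegral_ofReal hgci.integrableOn (.of_forall fun x => by positivity),
      ENNReal.ofReal_mul ht.le, ENNReal.ofReal_mul hC,
      ofReal_integral_eq_lintegral_ofReal hgi (.of_forall fun x => by positivity)]
    calc ∫⁻ x in Sᶜ, ENNReal.ofReal ((f x - c) ^ 2) ∂m
        ≤ ∫⁻ x in Sᶜ, ENNReal.ofReal t * ENNReal.ofReal (φ x * (f x - c) ^ 2) ∂m := by
          refine setLIntegral_mono' hSm.compl fun x hx => ?_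
          rw [← ENNReal.ofReal_mul ht.le]
          refine ENNReal.ofReal_le_ofReal ?_
          have h3 := one_div_le_of_enorm_lt_levelRadius hpos (not_le.1 hx)
          rw [div_le_iff₀ ht] at h3
          nlinarith [sq_nonneg (f x - c)]
      _ ≤ ∫⁻ x, ENNReal.ofReal t * ENNReal.ofReal (φ x * (f x - c) ^ 2) ∂m :=
          setLIntegral_le_lintegral _ _
      _ = ENNReal.ofReal t * ∫⁻ x, ENNReal.ofReal (φ x * (f x - c) ^ 2) ∂m :=
          lintegral_const_mul' _ _ ENNReal.ofReal_ne_top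
      _ ≤ _ := by gcongr
  have h3 : m.real S ≤ tailBeta μ ν φ t := conv_tail_le μ ν _
  have h4 := integral_add_compl hSm hgci
  nlinarith [sq_nonneg c, mul_le_mul_of_nonneg_right h3 (sq_nonneg (oscFun f))]

theorem weakPoincareBeta_of_weighted {μ ν : Measure (EuclideanSpace ℝ (Fin d))}
    [IsProbabilityMeasure μ] [IsProbabilityMeasure ν] {φ : EuclideanSpace ℝ (Fin d) → ℝ}
    (hφ : Continuous φ) (hpos : ∀ x, 0 < φ x) {C : ℝ} (hC : 0 < C)
    (h : ∀ f : EuclideanSpace ℝ (Fin d) → ℝ, ContDiff ℝ 1 f → (∃ K, ∀ x, |f x| ≤ K) → ∃ y,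
      ∫⁻ x, ENNReal.ofReal (φ x * (f x - f y) ^ 2) ∂(μ.conv ν) ≤
        ENNReal.ofReal C * ∫⁻ x, ENNReal.ofReal (‖gradient f x‖ ^ 2) ∂(μ.conv ν)) :
    WeakPoincareBeta μ ν φ := by
  refine ⟨fun s hs => exists_tailBeta_le hφ hpos hs, C, hC, ?_, ?_, ?_⟩
  · exact fun r _ => mul_nonneg hC.le (tailBetaInv_nonneg μ ν φ r)
  · intro r hr s _ hrs
    refine mul_le_mul_of_nonneg_left (csInf_le_csInf ⟨0, fun _ hx => hx.1.le⟩
      (exists_tailBeta_le hφ hpos hr) fun x hx => ⟨hx.1, hx.2.trans hrs⟩) hC.le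
  · intro f hf hb hb' hmean r hr
    obtain ⟨y, hy⟩ := h f hf hb
    set A := C * ∫ x, ‖gradient f x‖ ^ 2 ∂(μ.conv ν) with hA
    have hA0 : 0 ≤ A := mul_nonneg hC.le (integral_nonneg fun x => by positivity)
    have key : ∀ t ∈ {t : ℝ | 0 < t ∧ tailBeta μ ν φ t ≤ r},
        ∫ x, f x ^ 2 ∂(μ.conv ν) - r * oscFun f ^ 2 ≤ t * A := by
      rintro t ⟨ht, ht'⟩
      have := integral_sq_le_of_weighted hpos hf hb hb' hmean hC.le y hy ht
      nlinarith [mul_le_mul_of_nonneg_right ht' (sq_nonneg (oscFun f))]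
    have hne := exists_tailBeta_le (μ := μ) (ν := ν) hφ hpos hr
    have : ∫ x, f x ^ 2 ∂(μ.conv ν) - r * oscFun f ^ 2 ≤ tailBetaInv μ ν φ r * A := by
      -- To pass the infimum over t through the factor A, divide by A; when A = 0 a single
      -- admissible t suffices.
      rcases hA0.eq_or_lt with h0 | h0
      · obtain ⟨t, ht⟩ := hne
        simpa [← h0] using key t ht
      · rw [← div_le_iff₀ h0]
        exact le_csInf hne fun t ht => (div_le_iff₀ h0).2 (key t ht)
    have h5 : C * tailBetaInv μ ν φ r * ∫ x, ‖gradient f x‖ ^ 2 ∂(μ.conv ν) =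
      tailBetaInv μ ν φ r * A := by rw [hA]; ring
    linarith

/-! ### Poincaré inequality on a ball for Lebesgue measure -/

section LocalPoincare

variable {E : Type*} [NormedAddCommGroup E] [InnerProductSpace ℝ E]

theorem abs_sub_le_integral_segment {f : E → ℝ} (hf : ContDiff ℝ 1 f) (x y : E) :
    |f y - f x| ≤ ∫ t in (0 : ℝ)..1, ‖fderiv ℝ f (x + t • (y - x))‖ * ‖y - x‖ := by
  have hder : ∀ t : ℝ, HasDerivAt (fun t : ℝ => f (x + t • (y - x)))
      (fderiv ℝ f (x + t • (y - x)) (y - x)) t := by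
    intro t
    have h1 : HasDerivAt (fun t : ℝ => x + t • (y - x)) (y - x) t := by
      simpa using ((hasDerivAt_id t).smul_const (y - x)).const_add x
    exact ((hf.differentiable one_ne_zero) _).hasFDerivAt.comp_hasDerivAt t h1
  have hcf : Continuous fun t : ℝ => fderiv ℝ f (x + t • (y - x)) :=
    (hf.continuous_fderiv one_ne_zero).comp (by fun_prop)
  have hint := intervalIntegral.integral_eq_sub_of_hasDerivAt (a := 0) (b := 1)
    (fun t _ => hder t) ((hcf.clm_apply continuous_const).intervalIntegrable 0 1)
  simp only [one_smul, zero_smul, add_zero, add_sub_cancel] at hint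
  rw [← hint, ← Real.norm_eq_abs]
  refine intervalIntegral.norm_integral_le_of_norm_le zero_le_one (.of_forall fun t _ => ?_)
    ((hcf.norm.mul continuous_const).intervalIntegrable 0 1)
  exact ContinuousLinearMap.le_opNorm _ _

theorem sq_integral_le_integral_sq {k : ℝ → ℝ} (hk : Continuous k) :
    (∫ t in (0 : ℝ)..1, k t) ^ 2 ≤ ∫ t in (0 : ℝ)..1, k t ^ 2 := by
  set a := ∫ t in (0 : ℝ)..1, k t with ha
  -- Jensen for the square, as nonnegativity of the variance.
  have h0 : 0 ≤ ∫ t in (0 : ℝ)..1, (k t - a) ^ 2 :=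
    intervalIntegral.integral_nonneg zero_le_one fun t _ => sq_nonneg _
  have h1 : ∀ t, (k t - a) ^ 2 = k t ^ 2 - 2 * a * k t + a ^ 2 := fun t => by ring
  simp only [h1] at h0
  rw [intervalIntegral.integral_add (f := fun t => k t ^ 2 - 2 * a * k t)
    (Continuous.intervalIntegrable (by fun_prop) _ _) (by simp),
    intervalIntegral.integral_sub (Continuous.intervalIntegrable (by fun_prop) _ _)
    (Continuous.intervalIntegrable (by fun_prop) _ _), intervalIntegral.integral_const_mul,
    ← ha] at h0
  simp at h0
  nlinarith

theorem ofReal_sq_sub_le_lintegral_segment {f : E → ℝ} (hf : ContDiff ℝ 1 f) (x y : E) :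
    ENNReal.ofReal ((f x - f y) ^ 2) ≤ ENNReal.ofReal (‖y - x‖ ^ 2) *
      ∫⁻ t in Ioc (0 : ℝ) 1, ENNReal.ofReal (‖fderiv ℝ f (x + t • (y - x))‖ ^ 2) := by
  have hcf : Continuous fun t : ℝ => ‖fderiv ℝ f (x + t • (y - x))‖ :=
    ((hf.continuous_fderiv one_ne_zero).comp (by fun_prop)).norm
  have hi : IntegrableOn (fun t : ℝ => ‖fderiv ℝ f (x + t • (y - x))‖ ^ 2) (Ioc 0 1) :=
    (hcf.pow 2).integrableOn_Ioc
  rw [← ofReal_integral_eq_lintegral_ofReal hi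
    (.of_forall fun t => by positivity), ← ENNReal.ofReal_mul (by positivity),
    ← intervalIntegral.integral_of_le zero_le_one]
  refine ENNReal.ofReal_le_ofReal ?_
  have h1 := abs_sub_le_integral_segment hf x y
  rw [intervalIntegral.integral_mul_const] at h1
  have h2 := sq_integral_le_integral_sq hcf
  calc (f x - f y) ^ 2 = |f y - f x| ^ 2 := by rw [sq_abs]; ring
    _ ≤ ((∫ t in (0 : ℝ)..1, ‖fderiv ℝ f (x + t • (y - x))‖) * ‖y - x‖) ^ 2 := by gcongr
    _ = ‖y - x‖ ^ 2 * (∫ t in (0 : ℝ)..1, ‖fderiv ℝ f (x + t • (y - x))‖) ^ 2 := by ring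
    _ ≤ _ := by gcongr

variable [FiniteDimensional ℝ E] [MeasurableSpace E] [BorelSpace E]

theorem lintegral_comp_add_smul_le {g : E → ENNReal} (hg : Measurable g) (a : E) {c : ℝ}
    (hc : 1 / 2 ≤ c) :
    ∫⁻ x, g (a + c • x) ≤ 2 ^ Module.finrank ℝ E * ∫⁻ x, g x := by
  have hc0 : 0 < c := by linarith
  have hg' : Measurable fun x => g (a + x) := hg.comp (measurable_const_add a)
  have h1 : ∫⁻ x, g (a + c • x) = ∫⁻ x, g (a + x) ∂(Measure.map (c • ·) (volume : Measure E)) :=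
    (lintegral_map hg' (measurable_const_smul c)).symm
  rw [h1, Measure.map_addHaar_smul _ hc0.ne', lintegral_smul_measure, smul_eq_mul,
    lintegral_add_left_eq_self (fun x => g x) a]
  gcongr
  rw [abs_of_pos (by positivity), ← inv_pow, ENNReal.ofReal_pow (by positivity)]
  gcongr
  rw [← ENNReal.ofReal_ofNat 2]
  refine ENNReal.ofReal_le_ofReal ?_
  rw [inv_le_comm₀ hc0 two_pos]
  simpa using hc

/-- One of the weights t and 1-t is at least 1/2. Integrating first in the variable that carries it,
the affine change of variables costs at most 2 to the dimension, uniformly in t. -/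
theorem lintegral_lintegral_segment_le {g : E → ENNReal} (hg : Measurable g) (s : Set E) (t : ℝ) :
    ∫⁻ y in s, ∫⁻ x in s, g (x + t • (y - x)) ≤
      2 ^ Module.finrank ℝ E * (∫⁻ x, g x) * volume s := by
  rcases le_total (1 / 2) t with ht | ht
  · rw [lintegral_lintegral_swap (by fun_prop)]
    rw [← setLIntegral_const]
    refine lintegral_mono fun x => (setLIntegral_le_lintegral _ _).trans ?_
    refine le_trans (le_of_eq ?_) (lintegral_comp_add_smul_le hg ((1 - t) • x) ht)
    congr! 3 with y
    module
  · rw [← setLIntegral_const]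
    refine lintegral_mono fun y => (setLIntegral_le_lintegral _ _).trans ?_
    refine le_trans (le_of_eq ?_)
      (lintegral_comp_add_smul_le hg (t • y) (c := 1 - t) (by linarith))
    congr! 3 with x
    module

/-- Bound (f x - f y)² by the squared gradient along the segment, which stays in the convex ball,
and integrate over both endpoints. The point y is one where the integral in x does not exceed its
average over y, so the centre is a value of f. -/
theorem exists_local_poincare {R : ℝ} (hR : 0 < R) : ∃ C : ℝ≥0, ∀ f : E → ℝ, ContDiff ℝ 1 f →
    ∃ y, ∫⁻ x in Metric.closedBall 0 R, ENNReal.ofReal ((f x - f y) ^ 2) ≤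
      C * ∫⁻ x in Metric.closedBall 0 R, ENNReal.ofReal (‖fderiv ℝ f x‖ ^ 2) := by
  set B := Metric.closedBall (0 : E) R with hB
  have hBm : MeasurableSet B := measurableSet_closedBall
  have hB0 : volume B ≠ 0 := (Metric.measure_closedBall_pos _ _ hR).ne'
  have hBt : volume B ≠ ⊤ := measure_closedBall_lt_top.ne
  refine ⟨Real.toNNReal ((2 * R) ^ 2) * 2 ^ Module.finrank ℝ E, fun f hf => ?_⟩
  have hf'c := hf.continuous_fderiv one_ne_zero
  set g : E → ENNReal := B.indicator fun x => ENNReal.ofReal (‖fderiv ℝ f x‖ ^ 2) with hg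
  have hgm : Measurable g := by
    refine Measurable.indicator ?_ hBm
    exact (ENNReal.continuous_ofReal.comp (hf'c.norm.pow 2)).measurable
  have hgint : ∫⁻ x, g x = ∫⁻ x in B, ENNReal.ofReal (‖fderiv ℝ f x‖ ^ 2) :=
    lintegral_indicator hBm _
  have hpt : ∀ y ∈ B, ∀ x ∈ B, ENNReal.ofReal ((f x - f y) ^ 2) ≤
      ENNReal.ofReal ((2 * R) ^ 2) * ∫⁻ t in Ioc (0 : ℝ) 1, g (x + t • (y - x)) := by
    intro y hy x hx
    refine (ofReal_sq_sub_le_lintegral_segment hf x y).trans ?_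
    gcongr ?_ * ?_
    · refine ENNReal.ofReal_le_ofReal (pow_le_pow_left₀ (norm_nonneg _) ?_ 2)
      rw [hB, mem_closedBall_zero_iff] at hx hy
      linarith [norm_sub_le y x]
    · refine setLIntegral_mono' measurableSet_Ioc fun t ht => le_of_eq ?_
      have : x + t • (y - x) ∈ B :=
        (convex_closedBall _ _).add_smul_sub_mem hx hy ⟨ht.1.le, ht.2⟩
      rw [hg, indicator_of_mem this]
  have hmeas3 : Measurable fun p : (E × E) × ℝ => g (p.1.1 + p.2 • (p.1.2 - p.1.1)) :=
    hgm.comp (by fun_prop)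
  have hdouble : ∫⁻ y in B, ∫⁻ x in B, ENNReal.ofReal ((f x - f y) ^ 2) ≤
      ENNReal.ofReal ((2 * R) ^ 2) *
        (2 ^ Module.finrank ℝ E * (∫⁻ x, g x) * volume B) := by
    calc ∫⁻ y in B, ∫⁻ x in B, ENNReal.ofReal ((f x - f y) ^ 2)
        ≤ ∫⁻ y in B, ∫⁻ x in B, ENNReal.ofReal ((2 * R) ^ 2) *
            ∫⁻ t in Ioc (0 : ℝ) 1, g (x + t • (y - x)) :=
          setLIntegral_mono' hBm fun y hy => setLIntegral_mono' hBm fun x hx => hpt y hy x hx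
      _ = ENNReal.ofReal ((2 * R) ^ 2) *
            ∫⁻ y in B, ∫⁻ x in B, ∫⁻ t in Ioc (0 : ℝ) 1, g (x + t • (y - x)) := by
          simp_rw [lintegral_const_mul' _ _ ENNReal.ofReal_ne_top]
      _ = ENNReal.ofReal ((2 * R) ^ 2) *
            ∫⁻ t in Ioc (0 : ℝ) 1, ∫⁻ y in B, ∫⁻ x in B, g (x + t • (y - x)) := by
          congr 1
          rw [lintegral_lintegral_swap (μ := volume.restrict (Ioc (0 : ℝ) 1))]
          · refine lintegral_congr fun y => lintegral_lintegral_swap ?_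
            exact (hmeas3.comp (f := fun p : E × ℝ => ((p.1, y), p.2)) (by fun_prop)).aemeasurable
          · refine Measurable.aemeasurable ?_
            exact Measurable.lintegral_prod_right' (ν := volume.restrict B)
              (f := fun q : (ℝ × E) × E => g (q.2 + q.1.1 • (q.1.2 - q.2)))
              (hmeas3.comp (f := fun q : (ℝ × E) × E => ((q.2, q.1.2), q.1.1)) (by fun_prop))
      _ ≤ ENNReal.ofReal ((2 * R) ^ 2) *
            ∫⁻ t in Ioc (0 : ℝ) 1, 2 ^ Module.finrank ℝ E * (∫⁻ x, g x) * volume B := by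
          gcongr with t
          exact lintegral_lintegral_segment_le hgm B t
      _ = _ := by simp
  have hJm : AEMeasurable (fun y => ∫⁻ x in B, ENNReal.ofReal ((f x - f y) ^ 2))
      (volume.restrict B) := by
    refine Measurable.aemeasurable (Measurable.lintegral_prod_right'
      (f := fun p : E × E => ENNReal.ofReal ((f p.2 - f p.1) ^ 2)) ?_)
    have := hf.continuous
    exact (ENNReal.continuous_ofReal.comp (by fun_prop)).measurable
  obtain ⟨y, -, hy⟩ := exists_le_setLAverage hB0 hBt hJm
  refine ⟨y, hy.trans ?_⟩
  rw [setLAverage_eq, ENNReal.div_le_iff hB0 hBt, ← hgint]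
  refine hdouble.trans (le_of_eq ?_)
  rw [ENNReal.coe_mul, ENNReal.coe_pow, ENNReal.coe_ofNat, ENNReal.ofReal]
  ring

end LocalPoincare

/-! ### From functions vanishing on a ball to all bounded functions -/

section Weighted

variable {E : Type*} [NormedAddCommGroup E] [InnerProductSpace ℝ E] [FiniteDimensional ℝ E]

theorem ContDiffBump.exists_norm_fderiv_le (b : ContDiffBump (0 : E)) :
    ∃ K : ℝ, 0 ≤ K ∧ ∀ x, ‖fderiv ℝ b x‖ ≤ K := by
  have hc : Continuous (fderiv ℝ b) := b.contDiff (n := 1) |>.continuous_fderiv one_ne_zero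
  obtain ⟨K, hK⟩ := hc.bounded_above_of_compact_support (b.hasCompactSupport.fderiv (𝕜 := ℝ))
  exact ⟨K, (norm_nonneg _).trans (hK 0), hK⟩

theorem ContDiffBump.fderiv_eq_zero (b : ContDiffBump (0 : E)) {x : E} (hx : b.rOut < ‖x‖) :
    fderiv ℝ b x = 0 := by
  have : x ∉ tsupport b := by
    rw [b.tsupport_eq, mem_closedBall_zero_iff]
    exact not_le.2 hx
  exact image_eq_zero_of_notMem_tsupport fun h => this (tsupport_fderiv_subset ℝ h)

/-- The product rule gives three terms, whence the factor 3. Differentiating the inner cutoff leaves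
an error on a fixed ball; differentiating the outer one leaves an error of order 1/n. -/
theorem norm_fderiv_cutoff_sq_le {g : E → ℝ} (hg : ContDiff ℝ 1 g) {M : ℝ} (hM : ∀ x, |g x| ≤ M)
    (b₁ b₂ : ContDiffBump (0 : E)) {K₁ K₂ : ℝ}
    (hK₁ : ∀ x, ‖fderiv ℝ b₁ x‖ ≤ K₁) (hK₂ : ∀ x, ‖fderiv ℝ b₂ x‖ ≤ K₂) {n : ℝ} (hn : 0 < n)
    (x : E) :
    ‖fderiv ℝ (fun x => g x * (1 - b₁ x) * b₂ (n⁻¹ • x)) x‖ ^ 2 ≤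
      3 * ‖fderiv ℝ g x‖ ^ 2 +
        (3 * K₁ ^ 2 * (Metric.closedBall 0 b₁.rOut).indicator (fun x => g x ^ 2) x +
          3 * (K₂ * n⁻¹ * M) ^ 2) := by
  have hb₂ : HasFDerivAt (fun x => b₂ (n⁻¹ • x)) (n⁻¹ • fderiv ℝ b₂ (n⁻¹ • x)) x := by
    have h1 := ((b₂.contDiff (n := 1)).differentiable one_ne_zero (n⁻¹ • x)).hasFDerivAt
    have h2 := h1.comp x ((hasFDerivAt_id x).const_smul n⁻¹)
    refine h2.congr_fderiv ?_
    ext v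
    simp
  have hb₁ := ((b₁.contDiff (n := 1)).differentiable one_ne_zero x).hasFDerivAt.const_sub 1
  have hgx := (hg.differentiable one_ne_zero x).hasFDerivAt
  have hF : HasFDerivAt (fun x => g x * (1 - b₁ x) * b₂ (n⁻¹ • x))
      ((g x * (1 - b₁ x)) • n⁻¹ • fderiv ℝ b₂ (n⁻¹ • x) +
        b₂ (n⁻¹ • x) • (g x • -fderiv ℝ b₁ x + (1 - b₁ x) • fderiv ℝ g x)) x :=
    (hgx.mul hb₁).mul hb₂
  rw [hF.fderiv]
  have h1 : |1 - b₁ x| ≤ 1 := by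
    rw [abs_le]; constructor <;> linarith [b₁.nonneg (x := x), b₁.le_one (x := x)]
  have h2 : |b₂ (n⁻¹ • x)| ≤ 1 := by
    rw [abs_le]; constructor <;> linarith [b₂.nonneg (x := n⁻¹ • x), b₂.le_one (x := n⁻¹ • x)]
  have hK₁0 : 0 ≤ K₁ := (norm_nonneg _).trans (hK₁ x)
  have hK₂0 : 0 ≤ K₂ := (norm_nonneg _).trans (hK₂ x)
  have hM0 : 0 ≤ M := (abs_nonneg _).trans (hM x)
  set I := (Metric.closedBall 0 b₁.rOut).indicator (fun x => g x ^ 2) x with hI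
  have hA : ‖(g x * (1 - b₁ x)) • n⁻¹ • fderiv ℝ b₂ (n⁻¹ • x)‖ ≤ K₂ * n⁻¹ * M := by
    rw [norm_smul, norm_smul, norm_mul, Real.norm_eq_abs, Real.norm_eq_abs, Real.norm_eq_abs,
      abs_of_pos (inv_pos.2 hn)]
    calc |g x| * |1 - b₁ x| * (n⁻¹ * ‖fderiv ℝ b₂ (n⁻¹ • x)‖) ≤ M * 1 * (n⁻¹ * K₂) := by
          gcongr
          · exact hM x
          · exact hK₂ _
      _ = _ := by ring
  have hB : ‖b₂ (n⁻¹ • x) • (1 - b₁ x) • fderiv ℝ g x‖ ≤ ‖fderiv ℝ g x‖ := by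
    rw [norm_smul, norm_smul, Real.norm_eq_abs, Real.norm_eq_abs]
    calc _ ≤ 1 * (1 * ‖fderiv ℝ g x‖) := by gcongr
      _ = _ := by ring
  have hC : ‖b₂ (n⁻¹ • x) • g x • -fderiv ℝ b₁ x‖ ^ 2 ≤ K₁ ^ 2 * I := by
    rw [norm_smul, norm_smul, Real.norm_eq_abs, Real.norm_eq_abs, norm_neg]
    by_cases hx : x ∈ Metric.closedBall 0 b₁.rOut
    · rw [hI, indicator_of_mem hx, ← sq_abs (g x), ← mul_pow]
      refine pow_le_pow_left₀ (by positivity) ?_ 2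
      calc _ ≤ 1 * (|g x| * K₁) := by gcongr; exact hK₁ x
        _ = _ := by ring
    · rw [b₁.fderiv_eq_zero (by simpa using hx), hI, indicator_of_notMem hx]
      simp
  have htri : ‖(g x * (1 - b₁ x)) • n⁻¹ • fderiv ℝ b₂ (n⁻¹ • x) +
      b₂ (n⁻¹ • x) • (g x • -fderiv ℝ b₁ x + (1 - b₁ x) • fderiv ℝ g x)‖ ≤
      K₂ * n⁻¹ * M + (‖b₂ (n⁻¹ • x) • g x • -fderiv ℝ b₁ x‖ + ‖fderiv ℝ g x‖) := by
    rw [smul_add]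
    exact (norm_add_le _ _).trans (add_le_add hA ((norm_add_le _ _).trans (by gcongr)))
  refine (pow_le_pow_left₀ (norm_nonneg _) htri 2).trans ?_
  set u := ‖b₂ (n⁻¹ • x) • g x • -fderiv ℝ b₁ x‖
  nlinarith [sq_nonneg (K₂ * n⁻¹ * M - u), sq_nonneg (u - ‖fderiv ℝ g x‖),
    sq_nonneg (K₂ * n⁻¹ * M - ‖fderiv ℝ g x‖)]

variable [MeasurableSpace E] [BorelSpace E]

theorem setLIntegral_closedBall_le_of_density {p : E → ENNReal} (hp : Measurable p) {R : ℝ}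
    {a A : ℝ≥0} (ha : 0 < a) (hap : ∀ x ∈ Metric.closedBall (0 : E) R, a ≤ p x)
    (hpA : ∀ x ∈ Metric.closedBall (0 : E) R, p x ≤ A) {C : ℝ≥0} {u v : E → ENNReal}
    (hu : Measurable u) (hv : Measurable v)
    (h : ∫⁻ x in Metric.closedBall 0 R, u x ≤ C * ∫⁻ x in Metric.closedBall 0 R, v x) :
    ∫⁻ x in Metric.closedBall 0 R, u x ∂(volume.withDensity p) ≤
      ↑(A * C / a) * ∫⁻ x, v x ∂(volume.withDensity p) := by
  set B := Metric.closedBall (0 : E) R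
  have hB : MeasurableSet B := measurableSet_closedBall
  have h1 : ∫⁻ x in B, u x ∂(volume.withDensity p) ≤ A * ∫⁻ x in B, u x := by
    rw [setLIntegral_withDensity_eq_setLIntegral_mul _ hp hu hB,
      ← lintegral_const_mul' _ _ ENNReal.coe_ne_top]
    refine setLIntegral_mono' hB fun x hx => ?_
    simp only [Pi.mul_apply]
    gcongr
    exact hpA x hx
  have h2 : a * ∫⁻ x in B, v x ≤ ∫⁻ x, v x ∂(volume.withDensity p) := by
    refine le_trans ?_ (setLIntegral_le_lintegral B _)
    rw [setLIntegral_withDensity_eq_setLIntegral_mul _ hp hv hB,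
      ← lintegral_const_mul' _ _ ENNReal.coe_ne_top]
    refine setLIntegral_mono' hB fun x hx => ?_
    simp only [Pi.mul_apply]
    gcongr
    exact hap x hx
  calc _ ≤ A * (C * ∫⁻ x in B, v x) := h1.trans (by gcongr)
    _ = ↑(A * C / a) * (a * ∫⁻ x in B, v x) := by
      rw [← mul_assoc, ← mul_assoc, ← ENNReal.coe_mul, ← ENNReal.coe_mul,
        div_mul_cancel₀ _ ha.ne']
    _ ≤ _ := by gcongr

/-- Inside the ball of radius R+1 the local Poincaré inequality suffices, since φ and p are
controlled there. Outside, `H` is applied to f - f y times two cutoffs: the inner error is absorbed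
by the same local inequality, and the outer one vanishes as n grows because f is bounded and the
total mass is at most 1. -/
theorem exists_weighted_poincare {p : E → ENNReal} (hp : Measurable p)
    (hp1 : volume.withDensity p univ ≤ 1)
    (hlow : ∀ R : ℝ, ∃ a : ℝ≥0, 0 < a ∧ ∀ x ∈ Metric.closedBall (0 : E) R, a ≤ p x)
    (hupp : ∀ R : ℝ, ∃ A : ℝ≥0, ∀ x ∈ Metric.closedBall (0 : E) R, p x ≤ A)
    {φ : E → ℝ} (hφ : Continuous φ) (hpos : ∀ x, 0 < φ x) {R : ℝ} (hR : 0 < R)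
    (H : ∀ F : E → ℝ, ContDiff ℝ 1 F → HasCompactSupport F → (∀ x, ‖x‖ ≤ R → F x = 0) →
      ∫⁻ x, ENNReal.ofReal (φ x * F x ^ 2) ∂(volume.withDensity p) ≤
        ∫⁻ x, ENNReal.ofReal (‖fderiv ℝ F x‖ ^ 2) ∂(volume.withDensity p)) :
    ∃ C : ℝ, 0 < C ∧ ∀ f : E → ℝ, ContDiff ℝ 1 f → (∃ K, ∀ x, |f x| ≤ K) → ∃ y,
      ∫⁻ x, ENNReal.ofReal (φ x * (f x - f y) ^ 2) ∂(volume.withDensity p) ≤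
        ENNReal.ofReal C *
          ∫⁻ x, ENNReal.ofReal (‖fderiv ℝ f x‖ ^ 2) ∂(volume.withDensity p) := by
  set m := volume.withDensity p with hm
  set B := Metric.closedBall (0 : E) (R + 1) with hB
  have hBm : MeasurableSet B := measurableSet_closedBall
  obtain ⟨a, ha, hap⟩ := hlow (R + 1)
  obtain ⟨A, hpA⟩ := hupp (R + 1)
  obtain ⟨C₀, hC₀⟩ := exists_local_poincare (E := E) (R := R + 1) (by linarith)
  obtain ⟨x₁, -, hx₁⟩ := (isCompact_closedBall (0 : E) (R + 1)).exists_isMaxOn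
    ⟨0, by simp; linarith⟩ hφ.continuousOn
  let b₁ : ContDiffBump (0 : E) := ⟨R, R + 1, hR, by linarith⟩
  let b₂ : ContDiffBump (0 : E) := ⟨1, 2, one_pos, one_lt_two⟩
  obtain ⟨K₁, hK₁0, hK₁⟩ := b₁.exists_norm_fderiv_le
  obtain ⟨K₂, hK₂0, hK₂⟩ := b₂.exists_norm_fderiv_le
  set C₁ : ℝ≥0 := A * C₀ / a with hC₁
  -- The first summand, with φ x₁ the maximum of φ on the ball, pays for the inside; the bracket
  -- pays for the outside.
  refine ⟨φ x₁ * C₁ + (3 + 3 * K₁ ^ 2 * C₁), by have := hpos x₁; positivity, fun f hf hb => ?_⟩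
  obtain ⟨M₀, hM₀⟩ := hb
  obtain ⟨y, hy⟩ := hC₀ f hf
  refine ⟨y, ?_⟩
  set g : E → ℝ := fun x => f x - f y with hg
  have hgC : ContDiff ℝ 1 g := hf.sub contDiff_const
  have hgcont := hgC.continuous
  have hfg : ∀ x, fderiv ℝ g x = fderiv ℝ f x := fun x => by simp [hg, fderiv_sub_const]
  have hf'c := hf.continuous_fderiv one_ne_zero
  set M := M₀ + M₀ with hMdef
  have hM : ∀ x, |g x| ≤ M := fun x => (abs_sub _ _).trans (add_le_add (hM₀ _) (hM₀ _))
  set D := ∫⁻ x, ENNReal.ofReal (‖fderiv ℝ f x‖ ^ 2) ∂m with hD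
  have hg2m : Measurable fun x => ENNReal.ofReal (g x ^ 2) := by fun_prop
  have hf2m : Measurable fun x => ENNReal.ofReal (‖fderiv ℝ f x‖ ^ 2) := by fun_prop
  have hball : ∫⁻ x in B, ENNReal.ofReal (g x ^ 2) ∂m ≤ C₁ * D :=
    setLIntegral_closedBall_le_of_density hp ha hap hpA hg2m hf2m hy
  have hin : ∫⁻ x in B, ENNReal.ofReal (φ x * g x ^ 2) ∂m ≤ ENNReal.ofReal (φ x₁ * C₁) * D := by
    rw [ENNReal.ofReal_mul (hpos x₁).le, mul_assoc, ENNReal.ofReal_coe_nnreal]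
    calc ∫⁻ x in B, ENNReal.ofReal (φ x * g x ^ 2) ∂m
        ≤ ∫⁻ x in B, ENNReal.ofReal (φ x₁) * ENNReal.ofReal (g x ^ 2) ∂m := by
          refine setLIntegral_mono' hBm fun x hx => ?_
          rw [← ENNReal.ofReal_mul (hpos x₁).le]
          exact ENNReal.ofReal_le_ofReal (mul_le_mul_of_nonneg_right (hx₁ hx) (sq_nonneg _))
      _ = ENNReal.ofReal (φ x₁) * ∫⁻ x in B, ENNReal.ofReal (g x ^ 2) ∂m :=
          lintegral_const_mul' _ _ ENNReal.ofReal_ne_top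
      _ ≤ _ := by gcongr
  have hcut : ∀ n : ℝ, 0 < n →
      ∫⁻ x in Metric.closedBall 0 n \ B, ENNReal.ofReal (φ x * g x ^ 2) ∂m ≤
        ENNReal.ofReal (3 + 3 * K₁ ^ 2 * C₁) * D + ENNReal.ofReal (3 * (K₂ * n⁻¹ * M) ^ 2) := by
    intro n hn
    set F : E → ℝ := fun x => g x * (1 - b₁ x) * b₂ (n⁻¹ • x) with hF
    have hFC : ContDiff ℝ 1 F := by
      refine (hgC.mul (contDiff_const.sub b₁.contDiff)).mul ?_
      exact b₂.contDiff.comp (contDiff_const_smul _)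
    have hFs : HasCompactSupport F :=
      HasCompactSupport.mul_left (b₂.hasCompactSupport.comp_smul (inv_ne_zero hn.ne'))
    have hF0 : ∀ x, ‖x‖ ≤ R → F x = 0 := by
      intro x hx
      have : b₁ x = 1 := b₁.one_of_mem_closedBall (by simpa using hx)
      simp [hF, this]
    have hFeq : ∀ x ∈ Metric.closedBall 0 n \ B, F x = g x := by
      rintro x ⟨hx, hx'⟩
      have h1 : b₁ x = 0 := b₁.zero_of_le_dist (by
        have : ¬ ‖x‖ ≤ R + 1 := by simpa [hB] using hx'
        simpa using (not_le.1 this).le)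
      have h2 : b₂ (n⁻¹ • x) = 1 := b₂.one_of_mem_closedBall (by
        rw [mem_closedBall_zero_iff] at hx ⊢
        rw [norm_smul, norm_inv, Real.norm_of_nonneg hn.le, inv_mul_le_iff₀ hn]
        simpa [b₂] using hx)
      simp [hF, h1, h2]
    calc ∫⁻ x in Metric.closedBall 0 n \ B, ENNReal.ofReal (φ x * g x ^ 2) ∂m
        = ∫⁻ x in Metric.closedBall 0 n \ B, ENNReal.ofReal (φ x * F x ^ 2) ∂m :=
          setLIntegral_congr_fun (measurableSet_closedBall.diff hBm) fun x hx => by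
            simp only [hFeq x hx]
      _ ≤ ∫⁻ x, ENNReal.ofReal (φ x * F x ^ 2) ∂m := setLIntegral_le_lintegral _ _
      _ ≤ ∫⁻ x, ENNReal.ofReal (‖fderiv ℝ F x‖ ^ 2) ∂m := H F hFC hFs hF0
      _ ≤ ∫⁻ x, (ENNReal.ofReal 3 * ENNReal.ofReal (‖fderiv ℝ f x‖ ^ 2) +
            (ENNReal.ofReal (3 * K₁ ^ 2) * B.indicator (fun x => ENNReal.ofReal (g x ^ 2)) x +
              ENNReal.ofReal (3 * (K₂ * n⁻¹ * M) ^ 2))) ∂m := by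
          refine lintegral_mono fun x => ?_
          have h3 := norm_fderiv_cutoff_sq_le hgC hM b₁ b₂ hK₁ hK₂ hn x
          rw [hfg] at h3
          refine (ENNReal.ofReal_le_ofReal h3).trans ?_
          have hI0 : 0 ≤ B.indicator (fun x => g x ^ 2) x :=
            indicator_nonneg (fun _ _ => sq_nonneg _) x
          have hIe : B.indicator (fun x => ENNReal.ofReal (g x ^ 2)) x =
              ENNReal.ofReal (B.indicator (fun x => g x ^ 2) x) := by
            by_cases hx : x ∈ B <;> simp [hx]
          rw [hIe, ← ENNReal.ofReal_mul (by positivity), ← ENNReal.ofReal_mul (by positivity),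
            ← ENNReal.ofReal_add (by positivity) (by positivity),
            ← ENNReal.ofReal_add (by positivity) (by positivity)]
      _ = ENNReal.ofReal 3 * D + (ENNReal.ofReal (3 * K₁ ^ 2) *
            ∫⁻ x in B, ENNReal.ofReal (g x ^ 2) ∂m +
              ENNReal.ofReal (3 * (K₂ * n⁻¹ * M) ^ 2) * m univ) := by
          rw [lintegral_add_left (hf2m.const_mul _),
            lintegral_add_left ((hg2m.indicator hBm).const_mul _),
            lintegral_const_mul' _ _ ENNReal.ofReal_ne_top,
            lintegral_const_mul' _ _ ENNReal.ofReal_ne_top, lintegral_indicator hBm,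
            lintegral_const]
      _ ≤ ENNReal.ofReal 3 * D + (ENNReal.ofReal (3 * K₁ ^ 2) * (C₁ * D) +
              ENNReal.ofReal (3 * (K₂ * n⁻¹ * M) ^ 2) * 1) := by gcongr
      _ = _ := by
          rw [ENNReal.ofReal_add (by positivity) (by positivity),
            ENNReal.ofReal_mul (by positivity : (0 : ℝ) ≤ 3 * K₁ ^ 2), ENNReal.ofReal_coe_nnreal]
          ring
  have hlim : Tendsto (fun n : ℕ => ENNReal.ofReal (3 + 3 * K₁ ^ 2 * C₁) * D +
      ENNReal.ofReal (3 * (K₂ * (n : ℝ)⁻¹ * M) ^ 2)) atTop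
      (𝓝 (ENNReal.ofReal (3 + 3 * K₁ ^ 2 * C₁) * D)) := by
    have h1 : Tendsto (fun n : ℕ => 3 * (K₂ * (n : ℝ)⁻¹ * M) ^ 2) atTop (𝓝 0) := by
      have := (((tendsto_inv_atTop_nhds_zero_nat (𝕜 := ℝ)).const_mul K₂).mul_const M).pow 2
        |>.const_mul 3
      simpa using this
    have h2 := (ENNReal.tendsto_ofReal h1).const_add (ENNReal.ofReal (3 + 3 * K₁ ^ 2 * C₁) * D)
    simpa using h2
  have hout : ∫⁻ x in Bᶜ, ENNReal.ofReal (φ x * g x ^ 2) ∂m ≤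
      ENNReal.ofReal (3 + 3 * K₁ ^ 2 * C₁) * D := by
    have hU : Bᶜ = ⋃ n : ℕ, Metric.closedBall (0 : E) n \ B := by
      rw [← iUnion_sdiff, Metric.iUnion_closedBall_nat, compl_eq_univ_sdiff]
    have hmono : Monotone fun n : ℕ => Metric.closedBall (0 : E) n \ B := fun i j hij =>
      sdiff_subset_sdiff_left (Metric.closedBall_subset_closedBall (by exact_mod_cast hij))
    rw [hU, setLIntegral_iUnion_of_directed _ hmono.directed_le]
    -- The region is held at radius n while the cutoff radius k ≥ n tends to infinity.
    refine iSup_le fun n => ge_of_tendsto hlim ?_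
    filter_upwards [eventually_ge_atTop n, eventually_gt_atTop 0] with k hk hk0
    exact (lintegral_mono_set (hmono hk)).trans (hcut k (by exact_mod_cast hk0))
  rw [← lintegral_add_compl _ hBm, ENNReal.ofReal_add (by have := hpos x₁; positivity)
    (by positivity), add_mul]
  exact add_le_add hin hout

end Weighted

/-! ### The convolution as a mixture: local bounds and integration over fibres -/

section Mixture

variable {V : EuclideanSpace ℝ (Fin d) → ℝ} {ν : Measure (EuclideanSpace ℝ (Fin d))}

/-- The density of `gibbs V ∗ ν` with respect to Lebesgue measure, with values in `[0, ∞]`. -/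
noncomputable def convLDensity (V : EuclideanSpace ℝ (Fin d) → ℝ)
    (ν : Measure (EuclideanSpace ℝ (Fin d))) (x : EuclideanSpace ℝ (Fin d)) : ENNReal :=
  ∫⁻ z, ENNReal.ofReal (Real.exp (-V (x - z))) ∂ν

theorem measurable_convLDensity [SFinite ν] (hV : Continuous V) : Measurable (convLDensity V ν) :=
  Measurable.lintegral_prod_right'
    (f := fun p : EuclideanSpace ℝ (Fin d) × EuclideanSpace ℝ (Fin d) =>
      ENNReal.ofReal (Real.exp (-V (p.1 - p.2)))) (by fun_prop)

theorem gibbs_conv_eq_withDensity [SFinite ν] [SFinite (gibbs V)] (hV : Continuous V) :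
    (gibbs V).conv ν = volume.withDensity (convLDensity V ν) := by
  ext s hs
  have hs1 : Measurable (s.indicator (1 : EuclideanSpace ℝ (Fin d) → ENNReal)) :=
    measurable_one.indicator hs
  rw [← lintegral_indicator_one hs, Measure.lintegral_conv hs1, withDensity_apply _ hs,
    ← lintegral_indicator hs, lintegral_lintegral_swap (by fun_prop)]
  have h1 : ∀ z, ∫⁻ x, s.indicator (1 : EuclideanSpace ℝ (Fin d) → ENNReal) (x + z) ∂(gibbs V) =
      ∫⁻ x, s.indicator (fun x => ENNReal.ofReal (Real.exp (-V (x - z)))) x := by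
    intro z
    rw [gibbs, lintegral_withDensity_eq_lintegral_mul _ (by fun_prop) (by fun_prop)]
    refine Eq.trans (lintegral_congr fun x => ?_) (lintegral_add_right_eq_self _ z)
    by_cases hx : x + z ∈ s <;> simp [hx]
  simp_rw [h1]
  rw [lintegral_lintegral_swap]
  · refine lintegral_congr fun x => ?_
    by_cases hx : x ∈ s <;> simp [hx, convLDensity]
  · refine Measurable.aemeasurable ?_
    have : Measurable ((univ ×ˢ s : Set (EuclideanSpace ℝ (Fin d) × EuclideanSpace ℝ (Fin d))).indicator
        fun q => ENNReal.ofReal (Real.exp (-V (q.2 - q.1)))) :=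
      Measurable.indicator (by fun_prop) (MeasurableSet.univ.prod hs)
    convert this using 1
    ext q
    by_cases hq : q.2 ∈ s <;> simp [Function.uncurry, indicator, hq]

/-- Some ball of radius N carries positive ν-mass, and e^{-V} has a positive minimum on the ball of
radius R+N. -/
theorem exists_le_convLDensity [IsProbabilityMeasure ν] (hV : Continuous V) (R : ℝ) :
    ∃ a : ℝ≥0, 0 < a ∧ ∀ x ∈ Metric.closedBall (0 : EuclideanSpace ℝ (Fin d)) R,
      a ≤ convLDensity V ν x := by
  obtain ⟨N, hN⟩ : ∃ N : ℕ, 0 < ν (Metric.closedBall 0 N) := by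
    by_contra! hc
    have := measure_iUnion_null (μ := ν)
      (s := fun n : ℕ => Metric.closedBall (0 : EuclideanSpace ℝ (Fin d)) n)
      fun n => nonpos_iff_eq_zero.1 (hc n)
    rw [Metric.iUnion_closedBall_nat] at this
    simp at this
  by_cases hR : 0 ≤ R
  swap
  · exact ⟨1, one_pos, fun x hx => absurd ((norm_nonneg x).trans (by simpa using hx)) hR⟩
  have hc : Continuous fun x => Real.exp (-V x) := by fun_prop
  obtain ⟨x₀, -, hx₀⟩ := (isCompact_closedBall (0 : EuclideanSpace ℝ (Fin d))
    (R + N)).exists_isMinOn ⟨0, by simp; positivity⟩ hc.continuousOn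
  refine ⟨Real.toNNReal (Real.exp (-V x₀)) * (ν (Metric.closedBall 0 N)).toNNReal, ?_,
    fun x hx => ?_⟩
  · exact mul_pos (by simp [Real.exp_pos]) (ENNReal.toNNReal_pos hN.ne' (measure_ne_top _ _))
  · rw [ENNReal.coe_mul, ENNReal.coe_toNNReal (measure_ne_top _ _), ← setLIntegral_const]
    refine le_trans (setLIntegral_mono' measurableSet_closedBall fun z hz => ?_)
      (setLIntegral_le_lintegral (Metric.closedBall 0 (N : ℝ)) _)
    refine ENNReal.ofReal_le_ofReal (hx₀ ?_)
    rw [mem_closedBall_zero_iff] at hx hz ⊢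
    exact (norm_sub_le _ _).trans (add_le_add hx hz)

theorem exp_neg_le_add_lintegral (hV : ContDiff ℝ 1 V) (x y : EuclideanSpace ℝ (Fin d)) :
    ENNReal.ofReal (Real.exp (-V x)) ≤ ENNReal.ofReal (Real.exp (-V y)) +
      ENNReal.ofReal ‖y - x‖ * ∫⁻ t in Ioc (0 : ℝ) 1, ENNReal.ofReal
        (‖gradient V (x + t • (y - x))‖ * Real.exp (-V (x + t • (y - x)))) := by
  have hder : ∀ w, ‖fderiv ℝ (fun w => Real.exp (-V w)) w‖ = ‖gradient V w‖ * Real.exp (-V w) := by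
    intro w
    have h : HasFDerivAt (fun w => Real.exp (-V w)) (Real.exp (-V w) • -fderiv ℝ V w) w :=
      ((hV.differentiable one_ne_zero w).hasFDerivAt.neg).exp
    rw [h.fderiv, norm_smul, norm_neg,
      norm_gradient_eq_norm_fderiv, Real.norm_of_nonneg (Real.exp_pos _).le, mul_comm]
  have hE : ContDiff ℝ 1 fun w => Real.exp (-V w) := hV.neg.exp
  have h1 := abs_sub_le_integral_segment hE x y
  simp only [hder] at h1
  have hc : Continuous fun t : ℝ =>
      ‖gradient V (x + t • (y - x))‖ * Real.exp (-V (x + t • (y - x))) := by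
    simp only [norm_gradient_eq_norm_fderiv]
    have h2 := hV.continuous_fderiv one_ne_zero
    have h3 := hV.continuous
    fun_prop
  have hi : IntegrableOn (fun t : ℝ =>
      ‖gradient V (x + t • (y - x))‖ * Real.exp (-V (x + t • (y - x)))) (Ioc 0 1) :=
    hc.integrableOn_Ioc
  rw [← ofReal_integral_eq_lintegral_ofReal hi (.of_forall fun t => by positivity),
    ← ENNReal.ofReal_mul (norm_nonneg _), ← intervalIntegral.integral_of_le zero_le_one,
    ← ENNReal.ofReal_add (Real.exp_pos _).le (mul_nonneg (norm_nonneg _)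
      (intervalIntegral.integral_nonneg zero_le_one fun t _ => by positivity))]
  refine ENNReal.ofReal_le_ofReal ?_
  rw [intervalIntegral.integral_mul_const] at h1
  linarith [neg_abs_le (Real.exp (-V y) - Real.exp (-V x))]

theorem lintegral_convLDensity [IsProbabilityMeasure ν] [IsProbabilityMeasure (gibbs V)]
    (hV : Continuous V) : ∫⁻ x, convLDensity V ν x = 1 := by
  have h : (gibbs V).conv ν univ = 1 := measure_univ
  rwa [gibbs_conv_eq_withDensity hV, withDensity_apply _ MeasurableSet.univ,
    Measure.restrict_univ] at h

/-- The density has integral 1, so it is finite at some y. The fundamental theorem of calculus along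
the segment from x to y then bounds it at x, because the local bound on the mixture of |∇V|e^{-V}
controls the increment. -/
theorem exists_convLDensity_le [IsProbabilityMeasure ν] [IsProbabilityMeasure (gibbs V)]
    (hV : ContDiff ℝ 1 V) (hb : LocallyBoundedMix V ν fun y => ‖gradient V y‖) (R : ℝ) :
    ∃ A : ℝ≥0, ∀ x ∈ Metric.closedBall (0 : EuclideanSpace ℝ (Fin d)) R,
      convLDensity V ν x ≤ A := by
  have hVc := hV.continuous
  have hfin : ∀ᵐ x : EuclideanSpace ℝ (Fin d), convLDensity V ν x < ⊤ :=
    ae_lt_top (measurable_convLDensity hVc) (by simp [lintegral_convLDensity hVc])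
  obtain ⟨y, hy⟩ := hfin.exists
  obtain ⟨C, hC⟩ := hb (max R ‖y‖)
  have hgm : Continuous fun w => ENNReal.ofReal (‖gradient V w‖ * Real.exp (-V w)) := by
    simp only [norm_gradient_eq_norm_fderiv]
    have h2 := hV.continuous_fderiv one_ne_zero
    exact ENNReal.continuous_ofReal.comp (by fun_prop)
  refine ⟨(convLDensity V ν y).toNNReal + (‖y‖₊ + Real.toNNReal R) * C, fun x hx => ?_⟩
  rw [mem_closedBall_zero_iff] at hx
  have hR : 0 ≤ R := (norm_nonneg x).trans hx
  have hpath : ∀ (z : EuclideanSpace ℝ (Fin d)) (t : ℝ),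
      x - z + t • (y - z - (x - z)) = x + t • (y - x) - z := fun z t => by module
  have hseg : ∀ t ∈ Ioc (0 : ℝ) 1, ‖x + t • (y - x)‖ ≤ max R ‖y‖ := by
    intro t ht
    have := (convex_closedBall (0 : EuclideanSpace ℝ (Fin d)) (max R ‖y‖)).add_smul_sub_mem
      (x := x) (y := y) (by simp [hx]) (by simp) ⟨ht.1.le, ht.2⟩
    simpa using this
  rw [ENNReal.coe_add, ENNReal.coe_toNNReal hy.ne, ENNReal.coe_mul]
  calc convLDensity V ν x
      ≤ ∫⁻ z, (ENNReal.ofReal (Real.exp (-V (y - z))) + ENNReal.ofReal ‖y - x‖ *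
          ∫⁻ t in Ioc (0 : ℝ) 1, ENNReal.ofReal
            (‖gradient V (x + t • (y - x) - z)‖ * Real.exp (-V (x + t • (y - x) - z)))) ∂ν := by
        refine lintegral_mono fun z => ?_
        have := exp_neg_le_add_lintegral hV (x - z) (y - z)
        simp only [hpath] at this
        rwa [sub_sub_sub_cancel_right] at this
    _ = convLDensity V ν y + ENNReal.ofReal ‖y - x‖ *
          ∫⁻ z, (∫⁻ t in Ioc (0 : ℝ) 1, ENNReal.ofReal
            (‖gradient V (x + t • (y - x) - z)‖ * Real.exp (-V (x + t • (y - x) - z)))) ∂ν := by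
        rw [lintegral_add_left (by fun_prop), lintegral_const_mul' _ _ ENNReal.ofReal_ne_top,
          convLDensity]
    _ = convLDensity V ν y + ENNReal.ofReal ‖y - x‖ *
          ∫⁻ t in Ioc (0 : ℝ) 1, ∫⁻ z, ENNReal.ofReal
            (‖gradient V (x + t • (y - x) - z)‖ * Real.exp (-V (x + t • (y - x) - z))) ∂ν := by
        rw [lintegral_lintegral_swap]
        exact (hgm.comp (g := fun w => ENNReal.ofReal (‖gradient V w‖ * Real.exp (-V w)))
          (f := fun q : EuclideanSpace ℝ (Fin d) × ℝ => x + q.2 • (y - x) - q.1)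
          (by fun_prop)).measurable.aemeasurable
    _ ≤ convLDensity V ν y + ENNReal.ofReal ‖y - x‖ * ∫⁻ t in Ioc (0 : ℝ) 1, C := by
        refine add_le_add le_rfl (mul_le_mul' le_rfl ?_)
        exact setLIntegral_mono' measurableSet_Ioc fun t ht => hC _ (hseg t ht)
    _ ≤ convLDensity V ν y + ↑(‖y‖₊ + Real.toNNReal R) * C := by
        refine add_le_add le_rfl (mul_le_mul' ?_ ?_)
        · rw [ENNReal.coe_add, ← ENNReal.ofReal_coe_nnreal (p := ‖y‖₊), coe_nnnorm]
          change _ ≤ _ + ENNReal.ofReal R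
          rw [← ENNReal.ofReal_add (norm_nonneg _) hR]
          exact ENNReal.ofReal_le_ofReal ((norm_sub_le _ _).trans (by linarith))
        · simp

theorem integrable_exp_neg_sub (hV : Continuous V) {x : EuclideanSpace ℝ (Fin d)}
    (hx : convLDensity V ν x < ⊤) : Integrable (fun z => Real.exp (-V (x - z))) ν := by
  refine ⟨by fun_prop, ?_⟩
  rw [hasFiniteIntegral_iff_ofReal (.of_forall fun z => (Real.exp_pos _).le)]
  exact hx

theorem ofReal_convDensity (hV : Continuous V) {x : EuclideanSpace ℝ (Fin d)}
    (hx : convLDensity V ν x < ⊤) : ENNReal.ofReal (convDensity V ν x) = convLDensity V ν x :=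
  ofReal_integral_eq_lintegral_ofReal (integrable_exp_neg_sub hV hx)
    (.of_forall fun _ => (Real.exp_pos _).le)

theorem convDensity_pos [NeZero ν] (hV : Continuous V) {x : EuclideanSpace ℝ (Fin d)}
    (hx : convLDensity V ν x < ⊤) : 0 < convDensity V ν x := by
  refine (integral_pos_iff_support_of_nonneg (fun _ => (Real.exp_pos _).le)
    (integrable_exp_neg_sub hV hx)).2 ?_
  have : (Function.support fun z => Real.exp (-V (x - z))) = univ := by
    ext z; simp [Real.exp_ne_zero]
  rw [this]
  exact (NeZero.ne (ν univ)).bot_lt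

theorem integral_tiltedNu [NeZero ν] (hV : Continuous V) {x : EuclideanSpace ℝ (Fin d)}
    (hx : convLDensity V ν x < ⊤) (j : EuclideanSpace ℝ (Fin d) → ℝ) :
    ∫ z, j z ∂(tiltedNu V ν x) =
      (∫ z, j z * Real.exp (-V (x - z)) ∂ν) / convDensity V ν x := by
  have hp := convDensity_pos hV hx
  rw [tiltedNu, integral_withDensity_eq_integral_toReal_smul (by fun_prop)
    (.of_forall fun z => ENNReal.ofReal_lt_top), ← integral_div]
  refine integral_congr_ae (.of_forall fun z => ?_)
  simp only [smul_eq_mul]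
  rw [ENNReal.toReal_ofReal (by positivity)]
  ring

/-- This is what legitimises Fubini: for x in a bounded set the ν-integrals are uniformly bounded,
and K vanishes for the other x. -/
theorem integrable_prod_of_locallyBoundedMix [SFinite ν]
    {w : EuclideanSpace ℝ (Fin d) → ℝ}
    (hw : LocallyBoundedMix V ν w) {K : EuclideanSpace ℝ (Fin d) × EuclideanSpace ℝ (Fin d) → ℝ}
    (hK : Continuous K) {M R : ℝ} (hM : 0 ≤ M)
    (hKw : ∀ q, |K q| ≤ M * (w (q.1 - q.2) * Real.exp (-V (q.1 - q.2))))
    (hK0 : ∀ q, R < ‖q.1‖ → K q = 0) : Integrable K (volume.prod ν) := by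
  refine ⟨hK.aestronglyMeasurable, ?_⟩
  obtain ⟨C, hC⟩ := hw R
  rw [HasFiniteIntegral, lintegral_prod _ hK.measurable.enorm.aemeasurable]
  calc ∫⁻ x, ∫⁻ z, ‖K (x, z)‖ₑ ∂ν
      ≤ ∫⁻ x, (Metric.closedBall (0 : EuclideanSpace ℝ (Fin d)) R).indicator
          (fun _ => ENNReal.ofReal M * C) x := by
        refine lintegral_mono fun x => ?_
        by_cases hx : ‖x‖ ≤ R
        · rw [indicator_of_mem (by simpa using hx)]
          refine le_trans ?_ (mul_le_mul_right (hC x hx) (ENNReal.ofReal M))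
          rw [← lintegral_const_mul' _ _ ENNReal.ofReal_ne_top]
          refine lintegral_mono fun z => ?_
          rw [← ENNReal.ofReal_mul hM, Real.enorm_eq_ofReal_abs]
          exact ENNReal.ofReal_le_ofReal (hKw (x, z))
        · simp [hK0 (x, _) (not_le.1 hx)]
    _ = ENNReal.ofReal M * C * volume (Metric.closedBall (0 : EuclideanSpace ℝ (Fin d)) R) := by
        rw [lintegral_indicator measurableSet_closedBall, setLIntegral_const]
    _ < ⊤ := by
        refine ENNReal.mul_lt_top (ENNReal.mul_lt_top ENNReal.ofReal_lt_top ENNReal.coe_lt_top) ?_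
        exact measure_closedBall_lt_top

theorem locallyBoundedMix_const_one (h : ∀ R : ℝ, ∃ A : ℝ≥0,
    ∀ x ∈ Metric.closedBall (0 : EuclideanSpace ℝ (Fin d)) R, convLDensity V ν x ≤ A) :
    LocallyBoundedMix V ν fun _ => 1 := by
  intro R
  obtain ⟨A, hA⟩ := h R
  refine ⟨A, fun x hx => ?_⟩
  simpa [convLDensity] using hA x (by simpa using hx)

theorem LocallyBoundedMix.mono {w w' : EuclideanSpace ℝ (Fin d) → ℝ}
    (hw : LocallyBoundedMix V ν w) (h : ∀ x, w' x ≤ w x) : LocallyBoundedMix V ν w' := by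
  intro R
  obtain ⟨C, hC⟩ := hw R
  refine ⟨C, fun x hx => (lintegral_mono fun z => ?_).trans (hC x hx)⟩
  exact ENNReal.ofReal_le_ofReal (mul_le_mul_of_nonneg_right (h _) (Real.exp_pos _).le)

theorem LocallyBoundedMix.add_one (hV : Continuous V) {w : EuclideanSpace ℝ (Fin d) → ℝ}
    (hw : LocallyBoundedMix V ν w) (h1 : LocallyBoundedMix V ν fun _ => 1) :
    LocallyBoundedMix V ν fun x => w x + 1 := by
  intro R
  obtain ⟨C, hC⟩ := hw R
  obtain ⟨A, hA⟩ := h1 R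
  refine ⟨C + A, fun x hx => ?_⟩
  rw [ENNReal.coe_add]
  refine le_trans ?_ (add_le_add (hC x hx) (hA x hx))
  rw [← lintegral_add_right _ (by fun_prop)]
  refine lintegral_mono fun z => ?_
  rw [add_mul]
  exact ENNReal.ofReal_add_le

/-- The kernel K links two computations: integrated in x at fixed z it obeys an integration-by-parts
bound, and integrated in z at fixed x it dominates φF²p_ν. Fubini joins them. -/
theorem lintegral_le_of_forall_fiber [IsProbabilityMeasure ν] [IsProbabilityMeasure (gibbs V)]
    (hV : Continuous V) (hfin : ∀ x, convLDensity V ν x < ⊤)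
    (h1 : LocallyBoundedMix V ν fun _ => 1) {F φ : EuclideanSpace ℝ (Fin d) → ℝ}
    (hF : ContDiff ℝ 1 F) (hFs : HasCompactSupport F) (hφ : Continuous φ)
    (hpos : ∀ x, 0 < φ x)
    {K : EuclideanSpace ℝ (Fin d) × EuclideanSpace ℝ (Fin d) → ℝ}
    (hK : Integrable K (volume.prod ν))
    (hfib : ∀ z, ∫ x, K (x, z) ≤ ∫ x, ‖fderiv ℝ F x‖ ^ 2 * Real.exp (-V (x - z)))
    (hle : ∀ x, φ x * F x ^ 2 * convDensity V ν x ≤ ∫ z, K (x, z) ∂ν) :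
    ∫⁻ x, ENNReal.ofReal (φ x * F x ^ 2) ∂(volume.withDensity (convLDensity V ν)) ≤
      ∫⁻ x, ENNReal.ofReal (‖fderiv ℝ F x‖ ^ 2) ∂(volume.withDensity (convLDensity V ν)) := by
  have hF'c := hF.continuous_fderiv one_ne_zero
  have hFc := hF.continuous
  have hpm := measurable_convLDensity (ν := ν) hV
  set G : EuclideanSpace ℝ (Fin d) → ℝ := fun x => ‖fderiv ℝ F x‖ ^ 2 with hG
  have hGc : Continuous G := hF'c.norm.pow 2
  have hGs : HasCompactSupport G := (hFs.fderiv (𝕜 := ℝ)).norm.comp_left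
    (g := fun t : ℝ => t ^ 2) (by simp)
  obtain ⟨R, hR⟩ := hGs.isCompact.isBounded.subset_closedBall 0
  obtain ⟨M, hM⟩ := hGc.bounded_above_of_compact_support hGs
  have hK2 : Integrable (fun q : EuclideanSpace ℝ (Fin d) × EuclideanSpace ℝ (Fin d) =>
      G q.1 * Real.exp (-V (q.1 - q.2))) (volume.prod ν) := by
    refine integrable_prod_of_locallyBoundedMix h1 (by fun_prop) (M := M) (R := R)
      ((norm_nonneg _).trans (hM 0)) (fun q => ?_) fun q hq => ?_
    · rw [abs_mul, abs_of_pos (Real.exp_pos _), one_mul]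
      exact mul_le_mul_of_nonneg_right (hM _) (Real.exp_pos _).le
    · have : G q.1 = 0 := by
        refine image_eq_zero_of_notMem_tsupport fun h => ?_
        have := hR h
        rw [mem_closedBall_zero_iff] at this
        linarith
      simp [this]
  have hmul : ∀ u : EuclideanSpace ℝ (Fin d) → ℝ, Continuous u → (∀ x, 0 ≤ u x) →
      ∫⁻ x, ENNReal.ofReal (u x) ∂(volume.withDensity (convLDensity V ν)) =
        ∫⁻ x, ENNReal.ofReal (u x * convDensity V ν x) := by
    intro u hu hu0
    rw [lintegral_withDensity_eq_lintegral_mul _ hpm (by fun_prop)]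
    refine lintegral_congr fun x => ?_
    rw [ENNReal.ofReal_mul (hu0 x), ofReal_convDensity hV (hfin x), Pi.mul_apply, mul_comm]
  have hp0 : ∀ x, 0 ≤ convDensity V ν x := fun x => (convDensity_pos hV (hfin x)).le
  rw [hmul (fun x => φ x * F x ^ 2) (by fun_prop)
    (fun x => mul_nonneg (hpos x).le (sq_nonneg _)), hmul G hGc fun x => by positivity]
  have hKle : ∀ x, 0 ≤ ∫ z, K (x, z) ∂ν := fun x =>
    (mul_nonneg (mul_nonneg (hpos x).le (sq_nonneg _)) (hp0 x)).trans (hle x)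
  have hGeq : ∀ x, G x * convDensity V ν x = ∫ z, G x * Real.exp (-V (x - z)) ∂ν := fun x => by
    rw [integral_const_mul, convDensity]
  calc ∫⁻ x, ENNReal.ofReal (φ x * F x ^ 2 * convDensity V ν x)
      ≤ ∫⁻ x, ENNReal.ofReal (∫ z, K (x, z) ∂ν) :=
        lintegral_mono fun x => ENNReal.ofReal_le_ofReal (hle x)
    _ = ENNReal.ofReal (∫ x, ∫ z, K (x, z) ∂ν) :=
        (ofReal_integral_eq_lintegral_ofReal hK.integral_prod_left (.of_forall hKle)).symm
    _ = ENNReal.ofReal (∫ z, (∫ x, K (x, z)) ∂ν) := by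
        rw [integral_integral_swap (f := fun x z => K (x, z)) hK]
    _ ≤ ENNReal.ofReal (∫ z, (∫ x, G x * Real.exp (-V (x - z))) ∂ν) :=
        ENNReal.ofReal_le_ofReal
          (integral_mono hK.integral_prod_right hK2.integral_prod_right hfib)
    _ = ENNReal.ofReal (∫ x, ∫ z, G x * Real.exp (-V (x - z)) ∂ν) := by
        rw [integral_integral_swap (f := fun x z => G x * Real.exp (-V (x - z))) hK2]
    _ = ∫⁻ x, ENNReal.ofReal (∫ z, G x * Real.exp (-V (x - z)) ∂ν) :=
        ofReal_integral_eq_lintegral_ofReal hK2.integral_prod_left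
          (.of_forall fun x => integral_nonneg fun z => by positivity)
    _ = _ := by simp_rw [hGeq]

end Mixture

/-! ### Extending the weight continuously from outside a ball -/

theorem exists_continuous_eqOn {X : Type*} [TopologicalSpace X] [NormalSpace X] {s : Set X}
    (hs : IsClosed s) {h : X → ℝ} (hh : ContinuousOn h s) :
    ∃ g : X → ℝ, Continuous g ∧ EqOn g h s := by
  obtain ⟨g, hg⟩ := ContinuousMap.exists_restrict_eq hs ⟨s.domRestrict h, hh.domRestrict⟩
  exact ⟨g, g.continuous, fun x hx => DFunLike.congr_fun hg ⟨x, hx⟩⟩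

/-- Tietze extension of log h, then exponentiation, so that positivity survives. -/
theorem exists_continuous_pos_eqOn {X : Type*} [TopologicalSpace X] [NormalSpace X] {s : Set X}
    (hs : IsClosed s) {h : X → ℝ} (hh : ContinuousOn h s) (hpos : ∀ x ∈ s, 0 < h x) :
    ∃ g : X → ℝ, Continuous g ∧ (∀ x, 0 < g x) ∧ EqOn g h s := by
  obtain ⟨g, hg, hgh⟩ := exists_continuous_eqOn hs (hh.log fun x hx => (hpos x hx).ne')
  refine ⟨fun x => Real.exp (g x), Real.continuous_exp.comp hg, fun x => Real.exp_pos _,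
    fun x hx => ?_⟩
  simp only [hgh hx, Real.exp_log (hpos x hx)]

/-! ### The radial profile p_σ -/

section Radial

theorem isClosed_le_norm {E : Type*} [NormedAddCommGroup E] (R : ℝ) :
    IsClosed {x : E | R ≤ ‖x‖} :=
  isClosed_le continuous_const continuous_norm

theorem sInf_image_sphere_le {E : Type*} [NormedAddCommGroup E] [ProperSpace E] {h : E → ℝ}
    {R : ℝ} (hh : ContinuousOn h {x | R ≤ ‖x‖}) {x : E} (hx : R ≤ ‖x‖) :
    sInf (h '' Metric.sphere 0 ‖x‖) ≤ h x := by
  refine csInf_le ?_ ⟨x, by simp, rfl⟩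
  refine ((isCompact_sphere (0 : E) ‖x‖).image_of_continuousOn (hh.mono fun y hy => ?_)).bddBelow
  rw [mem_sphere_zero_iff_norm] at hy
  exact hx.trans_eq hy.symm

/-- Extend h continuously and scale every sphere to the compact unit sphere. A globally continuous ψ
makes ∫ψ differentiable everywhere, and p_σ on [R₀, ∞) sees ψ only there. -/
theorem exists_continuous_eqOn_sInf_sphere {E : Type*} [NormedAddCommGroup E] [NormedSpace ℝ E]
    [ProperSpace E] {h : E → ℝ} {R : ℝ} (hR : 0 < R) (hh : ContinuousOn h {x | R ≤ ‖x‖}) :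
    ∃ ψ : ℝ → ℝ, Continuous ψ ∧ EqOn ψ (fun s => sInf (h '' Metric.sphere 0 s)) (Ici R) := by
  obtain ⟨g, hg, hgh⟩ := exists_continuous_eqOn (isClosed_le_norm R) hh
  refine ⟨fun s => sInf ((fun θ => g (s • θ)) '' Metric.sphere 0 1),
    (isCompact_sphere (0 : E) 1).continuous_sInf (by fun_prop), fun s hs => ?_⟩
  have hs0 : 0 < s := hR.trans_le hs
  dsimp only
  congr 1
  ext r
  constructor
  · rintro ⟨θ, hθ, rfl⟩
    have h1 : ‖s • θ‖ = s := by
      rw [norm_smul, Real.norm_of_nonneg hs0.le, mem_sphere_zero_iff_norm.1 hθ, mul_one]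
    exact ⟨s • θ, by simpa using h1, (hgh (by simpa [h1] using hs)).symm⟩
  · rintro ⟨x, hx, rfl⟩
    rw [mem_sphere_zero_iff_norm] at hx
    refine ⟨s⁻¹ • x, ?_, ?_⟩
    · rw [mem_sphere_zero_iff_norm, norm_smul, norm_inv, Real.norm_of_nonneg hs0.le, hx,
        inv_mul_cancel₀ hs0.ne']
    · dsimp only
      rw [smul_inv_smul₀ hs0.ne']
      exact hgh (by simpa [hx] using hs)

theorem pWeight_congr {R₀ σ : ℝ} {ψ ψ' : ℝ → ℝ} (h : EqOn ψ ψ' (Ici R₀)) {r : ℝ} (hr : R₀ ≤ r) :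
    pWeight d R₀ σ ψ r = pWeight d R₀ σ ψ' r := by
  rw [pWeight, pWeight, intervalIntegral.integral_congr fun u hu => h ?_]
  rw [uIcc_of_le hr] at hu
  exact hu.1

theorem pSigma_congr {R₀ σ : ℝ} {ψ ψ' : ℝ → ℝ} (h : EqOn ψ ψ' (Ici R₀)) {r : ℝ} (hr : R₀ ≤ r) :
    pSigma d R₀ σ ψ r = pSigma d R₀ σ ψ' r := by
  rw [pSigma, pSigma, pWeight_congr h hr, intervalIntegral.integral_congr fun u hu =>
    pWeight_congr h ?_]
  rw [uIcc_of_le hr] at hu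
  exact hu.1

variable {R₀ σ : ℝ} {ψ : ℝ → ℝ}

theorem pWeight_pos {r : ℝ} (hr : 0 < r) : 0 < pWeight d R₀ σ ψ r :=
  mul_pos (zpow_pos hr _) (Real.exp_pos _)

theorem hasDerivAt_pWeight (hψ : Continuous ψ) {r : ℝ} (hr : 0 < r) :
    HasDerivAt (pWeight d R₀ σ ψ)
      (pWeight d R₀ σ ψ r * ((1 - d) / r + σ / (σ + 1) * ψ r)) r := by
  have h1 := hasDerivAt_zpow (1 - (d : ℤ)) r (Or.inl hr.ne')
  have h2 : HasDerivAt (fun r => ∫ u in R₀..r, ψ u) (ψ r) r :=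
    intervalIntegral.integral_hasDerivAt_right (hψ.intervalIntegrable _ _)
      hψ.stronglyMeasurable.stronglyMeasurableAtFilter hψ.continuousAt
  refine (h1.mul (h2.const_mul (σ / (σ + 1))).exp).congr_deriv ?_
  rw [pWeight, zpow_sub_one₀ hr.ne']
  push_cast
  field_simp

theorem continuousOn_pWeight (hψ : Continuous ψ) : ContinuousOn (pWeight d R₀ σ ψ) (Ioi 0) :=
  fun _ hr => (hasDerivAt_pWeight hψ hr).continuousAt.continuousWithinAt

theorem hasDerivAt_integral_pWeight (hψ : Continuous ψ) (hR₀ : 0 < R₀) {r : ℝ} (hr : 0 < r) :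
    HasDerivAt (fun r => (∫ s in R₀..r, pWeight d R₀ σ ψ s) + 1) (pWeight d R₀ σ ψ r) r := by
  have hc := continuousOn_pWeight (d := d) (R₀ := R₀) (σ := σ) hψ
  refine (intervalIntegral.integral_hasDerivAt_right ?_ ?_ ?_).add_const 1
  · refine (hc.mono fun u hu => ?_).intervalIntegrable
    exact (lt_min hR₀ hr).trans_le hu.1
  · exact hc.stronglyMeasurableAtFilter isOpen_Ioi r hr
  · exact hc.continuousAt (Ioi_mem_nhds hr)

theorem one_le_integral_pWeight (hR₀ : 0 < R₀) {r : ℝ} (hr : R₀ ≤ r) :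
    1 ≤ (∫ s in R₀..r, pWeight d R₀ σ ψ s) + 1 := by
  have := intervalIntegral.integral_nonneg (μ := volume) (f := pWeight d R₀ σ ψ) hr fun u hu =>
    (pWeight_pos (hR₀.trans_le hu.1)).le
  linarith

theorem pSigma_pos (hR₀ : 0 < R₀) {r : ℝ} (hr : R₀ ≤ r) : 0 < pSigma d R₀ σ ψ r :=
  div_pos (one_pos.trans_le (one_le_integral_pWeight hR₀ hr)) (pWeight_pos (hR₀.trans_le hr))

theorem continuousOn_pSigma (hψ : Continuous ψ) (hR₀ : 0 < R₀) :
    ContinuousOn (pSigma d R₀ σ ψ) (Ioi 0) := fun _ hr =>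
  ((hasDerivAt_integral_pWeight hψ hR₀ hr).continuousAt.div
    (hasDerivAt_pWeight hψ hr).continuousAt (pWeight_pos hr).ne').continuousWithinAt

/-- The radial field `x ↦ x / (|x| p_σ(|x|))` solves a Riccati equation. -/
theorem exists_hasDerivAt_inv_mul_pSigma (hψ : Continuous ψ) (hR₀ : 0 < R₀) :
    ∃ b' : ℝ → ℝ, ContinuousOn b' (Ioi R₀) ∧
      (∀ r ∈ Ioi R₀, HasDerivAt (fun r => (r * pSigma d R₀ σ ψ r)⁻¹) (b' r) r) ∧
      ∀ r ∈ Ioi R₀, r * b' r + d * (r * pSigma d R₀ σ ψ r)⁻¹ +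
        (r * (r * pSigma d R₀ σ ψ r)⁻¹) ^ 2 = σ / (σ + 1) * ψ r / pSigma d R₀ σ ψ r := by
  set q := pWeight d R₀ σ ψ with hq
  set G : ℝ → ℝ := fun r => (∫ s in R₀..r, pWeight d R₀ σ ψ s) + 1 with hG
  -- Here 1/p_σ = q/G = G'/G is a logarithmic derivative w, so w' + w² = q'/G = ((1-d)/r + κψ)w with
  -- κ = σ/(σ+1); substituting w = rb is the Riccati equation.
  have hb : ∀ r, (r * pSigma d R₀ σ ψ r)⁻¹ = q r / (r * G r) := fun r => by
    rw [pSigma, ← hq, mul_div_assoc', inv_div]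
  have hqc : ContinuousOn q (Ioi R₀) :=
    (continuousOn_pWeight hψ).mono (Ioi_subset_Ioi hR₀.le)
  have hGc : ContinuousOn G (Ioi R₀) := fun r hr =>
    (hasDerivAt_integral_pWeight hψ hR₀ (hR₀.trans hr)).continuousAt.continuousWithinAt
  have hne : ∀ r ∈ Ioi R₀, r * G r ≠ 0 := fun r hr =>
    mul_ne_zero (hR₀.trans hr).ne' (one_pos.trans_le (one_le_integral_pWeight hR₀ (le_of_lt hr))).ne'
  refine ⟨fun r => (q r * ((1 - d) / r + σ / (σ + 1) * ψ r) * (r * G r) -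
    q r * (1 * G r + r * q r)) / (r * G r) ^ 2, ?_, fun r hr => ?_, fun r hr => ?_⟩
  · have : ContinuousOn (fun r : ℝ => (1 - d : ℝ) / r) (Ioi R₀) :=
      continuousOn_const.div continuousOn_id fun r hr => (hR₀.trans hr).ne'
    refine ContinuousOn.div (by fun_prop) (by fun_prop) fun r hr => pow_ne_zero 2 (hne r hr)
  · simp only [hb]
    exact (hasDerivAt_pWeight hψ (hR₀.trans hr)).div
      ((hasDerivAt_id r).mul (hasDerivAt_integral_pWeight hψ hR₀ (hR₀.trans hr))) (hne r hr)
  · have hr0 : r ≠ 0 := (hR₀.trans hr).ne'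
    have hG0 : G r ≠ 0 := right_ne_zero_of_mul (hne r hr)
    have hq0 : q r ≠ 0 := (pWeight_pos (hR₀.trans hr)).ne'
    have hp : pSigma d R₀ σ ψ r = G r / q r := rfl
    rw [hb, hp]
    generalize σ / (σ + 1) = κ
    field_simp
    ring

end Radial

/-- Where F does not vanish, the norm may be replaced by its maximum with R, which stays in the
region where c is continuous. This needs the margin R₀ < R. -/
theorem continuous_mul_comp_norm {E : Type*} [NormedAddCommGroup E] {F : E → ℝ} (hF : Continuous F) {R₀ R : ℝ} (hR : R₀ < R)
    (hF0 : ∀ x, ‖x‖ ≤ R → F x = 0) {c : ℝ → ℝ} (hc : ContinuousOn c (Ioi R₀)) :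
    Continuous fun x => F x * c ‖x‖ := by
  have h1 : Continuous fun r => c (max r R) :=
    hc.comp_continuous (by fun_prop) fun r => hR.trans_le (le_max_right _ _)
  have h2 : (fun x => F x * c ‖x‖) = fun x => F x * c (max ‖x‖ R) := by
    ext x
    rcases le_total ‖x‖ R with h | h
    · simp [hF0 x h]
    · rw [max_eq_left h]
  rw [h2]
  exact hF.mul (h1.comp continuous_norm)

/-! ### Integration by parts against a radial field -/

section RadialIntegration

variable {E : Type*} [NormedAddCommGroup E] [InnerProductSpace ℝ E] [FiniteDimensional ℝ E]
  [MeasurableSpace E] [BorelSpace E]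

/-- Integration by parts in each coordinate for the field k(x)x, whose divergence is x·∇k plus the
dimension times k. -/
theorem integral_mul_fderiv_self {k e : E → ℝ} (hk : ContDiff ℝ 1 k) (hks : HasCompactSupport k)
    (he : ContDiff ℝ 1 e) :
    ∫ x, k x * fderiv ℝ e x x =
      -∫ x, (fderiv ℝ k x x + Module.finrank ℝ E * k x) * e x := by
  set b := stdOrthonormalBasis ℝ E with hb
  have hk' := hk.continuous_fderiv one_ne_zero
  have he' := he.continuous_fderiv one_ne_zero
  have hkc := hk.continuous
  have hec := he.continuous
  have hsum : ∀ (L : E →L[ℝ] ℝ) (x : E), L x = ∑ i, inner ℝ (b i) x * L (b i) := by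
    intro L x
    conv_lhs => rw [← b.sum_repr' x]
    simp
  have hpart : ∀ i, ∫ x, k x * inner ℝ (b i) x * fderiv ℝ e x (b i) =
      -∫ x, (inner ℝ (b i) x * fderiv ℝ k x (b i) + k x) * e x := by
    intro i
    have hkC : ContDiff ℝ 1 fun x => k x * inner ℝ (b i) x :=
      hk.mul (contDiff_const.inner ℝ contDiff_id)
    have hd : ∀ x, fderiv ℝ (fun x => k x * inner ℝ (b i) x) x (b i) =
        inner ℝ (b i) x * fderiv ℝ k x (b i) + k x := by
      intro x
      have h1 : HasFDerivAt (fun x => inner ℝ (b i) x) (innerSL ℝ (b i)) x :=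
        (innerSL ℝ (b i)).hasFDerivAt
      have h2 : HasFDerivAt (fun x => k x * inner ℝ (b i) x)
          (k x • innerSL ℝ (b i) + inner ℝ (b i) x • fderiv ℝ k x) x :=
        ((hk.differentiable one_ne_zero x).hasFDerivAt).mul h1
      rw [h2.fderiv]
      simp [add_comm]
    have hs : HasCompactSupport fun x => k x * inner ℝ (b i) x := hks.mul_right
    have hs' : HasCompactSupport fun x => fderiv ℝ (fun x => k x * inner ℝ (b i) x) x (b i) :=
      hs.fderiv_apply (𝕜 := ℝ) (b i)
    have hc' := (hkC.continuous_fderiv one_ne_zero).clm_apply (continuous_const (y := b i))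
    rw [integral_mul_fderiv_eq_neg_fderiv_mul_of_integrable (μ := volume)]
    · simp_rw [hd]
    · exact (hc'.mul hec).integrable_of_hasCompactSupport hs'.mul_right
    · exact (hkC.continuous.mul (by fun_prop)).integrable_of_hasCompactSupport hs.mul_right
    · exact (hkC.continuous.mul hec).integrable_of_hasCompactSupport hs.mul_right
    · exact fun x _ => hkC.differentiable one_ne_zero x
    · exact fun x _ => he.differentiable one_ne_zero x
  have hL : ∀ x, k x * fderiv ℝ e x x = ∑ i, k x * inner ℝ (b i) x * fderiv ℝ e x (b i) := by
    intro x
    rw [hsum (fderiv ℝ e x), Finset.mul_sum]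
    simp only [mul_assoc]
  have hRt : ∀ x, (fderiv ℝ k x x + Module.finrank ℝ E * k x) * e x =
      ∑ i, (inner ℝ (b i) x * fderiv ℝ k x (b i) + k x) * e x := by
    intro x
    rw [← Finset.sum_mul, Finset.sum_add_distrib, ← hsum]
    simp
  have hks' : ∀ i, HasCompactSupport fun x => fderiv ℝ k x (b i) :=
    fun i => hks.fderiv_apply (𝕜 := ℝ) (b i)
  simp_rw [hL, hRt]
  rw [integral_finsetSum, integral_finsetSum, ← Finset.sum_neg_distrib]
  · exact Finset.sum_congr rfl fun i _ => hpart i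
  · exact fun i _ => Continuous.integrable_of_hasCompactSupport (by fun_prop)
      (((hks' i).mul_left.add hks).mul_right)
  · exact fun i _ => Continuous.integrable_of_hasCompactSupport (by fun_prop)
      (hks.mul_right.mul_right)

/-- The divergence of F²b(|x|)x is 2Fb x·∇F + F²(rb' + nb), with r = |x| and n the dimension.
Young's inequality bounds the first term by |∇F|² + F²(rb)², and the Riccati equation sums the rest
to F²Ψ. -/
theorem neg_integral_radial_le {b b' Ψ : ℝ → ℝ} {R₀ R : ℝ} (hR₀ : 0 ≤ R₀) (hR : R₀ < R)
    (hb : ∀ r ∈ Ioi R₀, HasDerivAt b (b' r) r) (hb' : ContinuousOn b' (Ioi R₀))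
    (hΨ : ContinuousOn Ψ (Ioi R₀))
    (hric : ∀ r ∈ Ioi R₀, r * b' r + Module.finrank ℝ E * b r + (r * b r) ^ 2 = Ψ r)
    {F e : E → ℝ} (hF : ContDiff ℝ 1 F) (hFs : HasCompactSupport F)
    (hF0 : ∀ x, ‖x‖ ≤ R → F x = 0) (he : ContDiff ℝ 1 e) (he0 : ∀ x, 0 ≤ e x) :
    -∫ x, F x ^ 2 * b ‖x‖ * fderiv ℝ e x x ≤
      ∫ x, (‖fderiv ℝ F x‖ ^ 2 + F x ^ 2 * Ψ ‖x‖) * e x := by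
  have hF'c := hF.continuous_fderiv one_ne_zero
  have hbC : ContDiffOn ℝ 1 b (Ioi R₀) := by
    rw [show (1 : WithTop ℕ∞) = 0 + 1 from rfl, contDiffOn_succ_iff_deriv_of_isOpen isOpen_Ioi]
    refine ⟨fun r hr => (hb r hr).differentiableAt.differentiableWithinAt, by simp, ?_⟩
    exact contDiffOn_zero.2 (hb'.congr fun r hr => (hb r hr).deriv)
  set k : E → ℝ := fun x => F x ^ 2 * b ‖x‖ with hk
  have hk0 : ∀ x, ‖x‖ < R → k =ᶠ[𝓝 x] fun _ => 0 := by
    intro x hx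
    filter_upwards [continuous_norm.continuousAt.eventually_lt_const hx] with y hy
    simp [hk, hF0 y (le_of_lt hy)]
  -- The vanishing of F on the ball hides both the singularity of the norm at 0 and the region where
  -- b is not known to be differentiable.
  have hkC : ContDiff ℝ 1 k := by
    refine contDiff_iff_contDiffAt.2 fun x => ?_
    rcases lt_or_ge ‖x‖ R with hx | hx
    · exact contDiffAt_const.congr_of_eventuallyEq (hk0 x hx)
    · have hx0 : x ≠ 0 := norm_pos_iff.1 (hR₀.trans_lt (hR.trans_le hx))
      exact (hF.contDiffAt.pow 2).mul ((hbC.contDiffAt (Ioi_mem_nhds (hR.trans_le hx))).comp x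
        (contDiffAt_norm ℝ hx0))
  have hF2s : HasCompactSupport fun x => F x ^ 2 :=
    hFs.comp_left (g := fun t : ℝ => t ^ 2) (by simp)
  have hks : HasCompactSupport k := hF2s.mul_right
  have hF20 : ∀ x, ‖x‖ ≤ R → F x ^ 2 = 0 := fun x hx => by simp [hF0 x hx]
  have hpt : ∀ x, fderiv ℝ k x x + Module.finrank ℝ E * k x ≤
      ‖fderiv ℝ F x‖ ^ 2 + F x ^ 2 * Ψ ‖x‖ := by
    intro x
    rcases lt_or_ge ‖x‖ R with hx | hx
    · rw [(hk0 x hx).fderiv_eq, (hk0 x hx).self_of_nhds, hF0 x hx.le]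
      simp
    · have hxR : R₀ < ‖x‖ := hR.trans_le hx
      have hx0 : x ≠ 0 := norm_pos_iff.1 (hR₀.trans_lt hxR)
      have hn : DifferentiableAt ℝ (fun y : E => ‖y‖) x :=
        (contDiffAt_norm ℝ hx0 (n := 1)).differentiableAt one_ne_zero
      have h1 : HasFDerivAt (fun y : E => b ‖y‖) (b' ‖x‖ • fderiv ℝ (fun y : E => ‖y‖) x) x :=
        (hb _ hxR).comp_hasFDerivAt x hn.hasFDerivAt
      have h2 : HasFDerivAt (fun y => F y ^ 2) ((2 * F x) • fderiv ℝ F x) x := by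
        simpa using (hF.differentiable one_ne_zero x).hasFDerivAt.pow 2
      have h3 : HasFDerivAt k (F x ^ 2 • b' ‖x‖ • fderiv ℝ (fun y : E => ‖y‖) x +
          b ‖x‖ • (2 * F x) • fderiv ℝ F x) x := h2.mul h1
      have h4 : fderiv ℝ (fun y : E => ‖y‖) x x = ‖x‖ := hn.fderiv_norm_self
      rw [h3.fderiv, ← hric _ hxR]
      simp only [add_apply, smul_apply, smul_eq_mul, h4]
      have h5 : |fderiv ℝ F x x| ≤ ‖fderiv ℝ F x‖ * ‖x‖ := (fderiv ℝ F x).le_opNorm x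
      have h6 : b ‖x‖ * (2 * F x * fderiv ℝ F x x) ≤
          2 * (|F x * b ‖x‖| * ‖x‖) * ‖fderiv ℝ F x‖ := by
        calc b ‖x‖ * (2 * F x * fderiv ℝ F x x) ≤ |b ‖x‖ * (2 * F x * fderiv ℝ F x x)| :=
              le_abs_self _
          _ = 2 * |F x * b ‖x‖| * |fderiv ℝ F x x| := by
              simp only [abs_mul, abs_two]; ring
          _ ≤ 2 * |F x * b ‖x‖| * (‖fderiv ℝ F x‖ * ‖x‖) := by gcongr
          _ = _ := by ring
      have h7 : (|F x * b ‖x‖| * ‖x‖) ^ 2 = F x ^ 2 * (‖x‖ * b ‖x‖) ^ 2 := by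
        rw [mul_pow, sq_abs]; ring
      nlinarith [sq_nonneg (|F x * b ‖x‖| * ‖x‖ - ‖fderiv ℝ F x‖)]
  have hkc' := hkC.continuous_fderiv one_ne_zero
  have hkc := hkC.continuous
  have hec := he.continuous
  rw [integral_mul_fderiv_self hkC hks he, neg_neg]
  refine integral_mono ?_ ?_ fun x => mul_le_mul_of_nonneg_right (hpt x) (he0 x)
  · refine Continuous.integrable_of_hasCompactSupport (by fun_prop) ?_
    refine HasCompactSupport.mul_right (HasCompactSupport.add ?_ hks.mul_left)
    exact (hks.fderiv (𝕜 := ℝ)).mono fun x hx => by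
      contrapose! hx
      simp only [Function.mem_support, not_not] at hx
      simp [hx]
  · have h1 : Continuous fun x => F x ^ 2 * Ψ ‖x‖ :=
      continuous_mul_comp_norm (hF.continuous.pow 2) hR hF20 hΨ
    refine Continuous.integrable_of_hasCompactSupport (by fun_prop) ?_
    refine HasCompactSupport.mul_right (HasCompactSupport.add ?_ hF2s.mul_right)
    exact (hFs.fderiv (𝕜 := ℝ)).norm.comp_left (g := fun t : ℝ => t ^ 2) (by simp)

end RadialIntegration

/-! ### Part (a): radial drift -/

section Main

variable {V : EuclideanSpace ℝ (Fin d) → ℝ} {ν : Measure (EuclideanSpace ℝ (Fin d))}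

theorem weakPoincareBeta_of_lyapunov [IsProbabilityMeasure (gibbs V)] [IsProbabilityMeasure ν]
    (hV : ContDiff ℝ 1 V) (hb : LocallyBoundedMix V ν fun y => ‖gradient V y‖)
    {φ : EuclideanSpace ℝ (Fin d) → ℝ} (hφ : Continuous φ) (hpos : ∀ x, 0 < φ x) {R : ℝ}
    (hR : 0 < R)
    (H : ∀ F : EuclideanSpace ℝ (Fin d) → ℝ, ContDiff ℝ 1 F → HasCompactSupport F →
      (∀ x, ‖x‖ ≤ R → F x = 0) →
      ∫⁻ x, ENNReal.ofReal (φ x * F x ^ 2) ∂(volume.withDensity (convLDensity V ν)) ≤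
        ∫⁻ x, ENNReal.ofReal (‖fderiv ℝ F x‖ ^ 2) ∂(volume.withDensity (convLDensity V ν))) :
    WeakPoincareBeta (gibbs V) ν φ := by
  have hVc := hV.continuous
  have hconv := gibbs_conv_eq_withDensity (ν := ν) hVc
  have h1 : volume.withDensity (convLDensity V ν) univ ≤ 1 := by
    rw [← hconv]
    exact prob_le_one
  obtain ⟨C, hC, hw⟩ := exists_weighted_poincare (measurable_convLDensity hVc) h1
    (exists_le_convLDensity hVc) (exists_convLDensity_le hV hb) hφ hpos hR H
  refine weakPoincareBeta_of_weighted hφ hpos hC fun f hf hfb => ?_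
  simp only [hconv, norm_gradient_eq_norm_fderiv]
  exact hw f hf hfb

theorem convLDensity_lt_top [IsProbabilityMeasure (gibbs V)] [IsProbabilityMeasure ν]
    (hV : ContDiff ℝ 1 V) (hb : LocallyBoundedMix V ν fun y => ‖gradient V y‖)
    (x : EuclideanSpace ℝ (Fin d)) : convLDensity V ν x < ⊤ := by
  obtain ⟨A, hA⟩ := exists_convLDensity_le hV hb ‖x‖
  exact (hA x (by simp)).trans_lt ENNReal.coe_lt_top

theorem integrable_of_locallyBoundedMix {w : EuclideanSpace ℝ (Fin d) → ℝ}
    (hw : LocallyBoundedMix V ν w) {x : EuclideanSpace ℝ (Fin d)}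
    {j : EuclideanSpace ℝ (Fin d) → ℝ} (hj : Continuous j) {M : ℝ} (hM : 0 ≤ M)
    (hjw : ∀ z, |j z| ≤ M * (w (x - z) * Real.exp (-V (x - z)))) : Integrable j ν := by
  obtain ⟨C, hC⟩ := hw ‖x‖
  refine ⟨hj.aestronglyMeasurable, ?_⟩
  calc ∫⁻ z, ‖j z‖ₑ ∂ν
      ≤ ∫⁻ z, ENNReal.ofReal M * ENNReal.ofReal (w (x - z) * Real.exp (-V (x - z))) ∂ν := by
        refine lintegral_mono fun z => ?_
        rw [← ENNReal.ofReal_mul hM, Real.enorm_eq_ofReal_abs]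
        exact ENNReal.ofReal_le_ofReal (hjw z)
    _ ≤ ENNReal.ofReal M * C := by
        rw [lintegral_const_mul' _ _ ENNReal.ofReal_ne_top]
        exact mul_le_mul_right (hC x le_rfl) _
    _ < ⊤ := ENNReal.mul_lt_top ENNReal.ofReal_lt_top ENNReal.coe_lt_top

theorem continuous_gradient {E : Type*} [NormedAddCommGroup E] [InnerProductSpace ℝ E]
    [CompleteSpace E] {f : E → ℝ} (hf : ContDiff ℝ 1 f) : Continuous (gradient f) :=
  (InnerProductSpace.toDual ℝ E).symm.continuous.comp (hf.continuous_fderiv one_ne_zero)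

theorem inner_gradient_eq_fderiv {E : Type*} [NormedAddCommGroup E] [InnerProductSpace ℝ E]
    [CompleteSpace E] (f : E → ℝ) (x v : E) : inner ℝ v (gradient f x) = fderiv ℝ f x v := by
  rw [real_inner_comm, gradient, InnerProductSpace.toDual_symm_apply]

theorem radialDrift_mul [IsProbabilityMeasure (gibbs V)] [IsProbabilityMeasure ν]
    (hV : ContDiff ℝ 1 V) (hb : LocallyBoundedMix V ν fun y => ‖gradient V y‖)
    {x : EuclideanSpace ℝ (Fin d)} (hx : x ≠ 0) :
    ‖x‖ * radialDrift V ν x * convDensity V ν x =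
      ∫ z, inner ℝ x (gradient V (x - z)) * Real.exp (-V (x - z)) ∂ν := by
  have hfin := convLDensity_lt_top hV hb x
  have hp := convDensity_pos hV.continuous hfin
  rw [radialDrift, integral_tiltedNu hV.continuous hfin, mul_div_cancel₀ _ (norm_ne_zero_iff.2 hx),
    div_mul_cancel₀ _ hp.ne']

/-- The radial estimate is used with e(x) = e^{-V(x-z)}, for which -x·∇e = ⟨x, ∇V(x-z)⟩e;
integrating in z turns this into |x| h(x) p_ν(x). -/
theorem lyapunov_of_radialDrift [IsProbabilityMeasure (gibbs V)] [IsProbabilityMeasure ν]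
    (hV : ContDiff ℝ 1 V) (hb : LocallyBoundedMix V ν fun y => ‖gradient V y‖) {R₀ σ : ℝ}
    (hR₀ : 0 < R₀) (hσ : 0 < σ) {ψ : ℝ → ℝ} (hψ : Continuous ψ)
    (hψle : ∀ x, R₀ ≤ ‖x‖ → ψ ‖x‖ ≤ radialDrift V ν x)
    {φ : EuclideanSpace ℝ (Fin d) → ℝ} (hφ : Continuous φ) (hpos : ∀ x, 0 < φ x)
    (hφeq : ∀ x, R₀ ≤ ‖x‖ → φ x = radialDrift V ν x / ((1 + σ) * pSigma d R₀ σ ψ ‖x‖))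
    {F : EuclideanSpace ℝ (Fin d) → ℝ} (hF : ContDiff ℝ 1 F) (hFs : HasCompactSupport F)
    (hF0 : ∀ x, ‖x‖ ≤ R₀ + 1 → F x = 0) :
    ∫⁻ x, ENNReal.ofReal (φ x * F x ^ 2) ∂(volume.withDensity (convLDensity V ν)) ≤
      ∫⁻ x, ENNReal.ofReal (‖fderiv ℝ F x‖ ^ 2) ∂(volume.withDensity (convLDensity V ν)) := by
  have hVc := hV.continuous
  have hVg := continuous_gradient hV
  have hfin := convLDensity_lt_top hV hb
  have h1 := locallyBoundedMix_const_one (exists_convLDensity_le hV hb)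
  obtain ⟨b', hb'c, hb', hric⟩ := exists_hasDerivAt_inv_mul_pSigma (d := d) (σ := σ) hψ hR₀
  set b : ℝ → ℝ := fun r => (r * pSigma d R₀ σ ψ r)⁻¹ with hbdef
  set Ψ : ℝ → ℝ := fun r => σ / (σ + 1) * ψ r / pSigma d R₀ σ ψ r with hΨdef
  have hpc : ContinuousOn (pSigma d R₀ σ ψ) (Ioi R₀) :=
    (continuousOn_pSigma hψ hR₀).mono (Ioi_subset_Ioi hR₀.le)
  have hΨc : ContinuousOn Ψ (Ioi R₀) :=
    ContinuousOn.div (by fun_prop) hpc fun r hr => (pSigma_pos hR₀ (le_of_lt hr)).ne'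
  have hbc : ContinuousOn b (Ioi R₀) := fun r hr => (hb' r hr).continuousAt.continuousWithinAt
  have hRR : R₀ < R₀ + 1 := by linarith
  have hF20 : ∀ x, ‖x‖ ≤ R₀ + 1 → F x ^ 2 = 0 := fun x hx => by simp [hF0 x hx]
  have hF2s : HasCompactSupport fun x => F x ^ 2 :=
    hFs.comp_left (g := fun t : ℝ => t ^ 2) (by simp)
  have hF'c := hF.continuous_fderiv one_ne_zero
  have hBc : Continuous fun x => F x ^ 2 * b ‖x‖ :=
    continuous_mul_comp_norm (hF.continuous.pow 2) hRR hF20 hbc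
  have hPc : Continuous fun x => F x ^ 2 * Ψ ‖x‖ :=
    continuous_mul_comp_norm (hF.continuous.pow 2) hRR hF20 hΨc
  obtain ⟨M₁, hM₁⟩ := (hBc.smul continuous_id).bounded_above_of_compact_support
    (hF2s.mul_right.smul_right (f' := fun x : EuclideanSpace ℝ (Fin d) => x))
  obtain ⟨M₂, hM₂⟩ := hPc.bounded_above_of_compact_support hF2s.mul_right
  have hM₁0 : 0 ≤ M₁ := (norm_nonneg _).trans (hM₁ 0)
  have hM₂0 : 0 ≤ M₂ := (norm_nonneg _).trans (hM₂ 0)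
  obtain ⟨R, hR⟩ := hFs.isCompact.isBounded.subset_closedBall 0
  have hFR : ∀ x, R < ‖x‖ → F x = 0 := by
    refine fun x hx => image_eq_zero_of_notMem_tsupport fun h => ?_
    have := hR h
    rw [mem_closedBall_zero_iff] at this
    linarith
  have hKint : Integrable (fun q : EuclideanSpace ℝ (Fin d) × EuclideanSpace ℝ (Fin d) =>
      (F q.1 ^ 2 * b ‖q.1‖ * inner ℝ q.1 (gradient V (q.1 - q.2)) - F q.1 ^ 2 * Ψ ‖q.1‖) *
        Real.exp (-V (q.1 - q.2))) (volume.prod ν) := by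
    -- The drift term costs |∇V| and the Ψ term costs 1, hence the majorant |∇V| + 1.
    refine integrable_prod_of_locallyBoundedMix (hb.add_one hVc h1) ?_ (M := M₁ + M₂) (R := R)
      (by positivity) (fun q => ?_) fun q hq => by simp [hFR _ hq]
    · have hBc' := hBc.comp (continuous_fst (X := EuclideanSpace ℝ (Fin d))
        (Y := EuclideanSpace ℝ (Fin d)))
      have hPc' := hPc.comp (continuous_fst (X := EuclideanSpace ℝ (Fin d))
        (Y := EuclideanSpace ℝ (Fin d)))
      exact ((hBc'.mul (by fun_prop)).sub hPc').mul (by fun_prop)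
    · rw [abs_mul, abs_of_pos (Real.exp_pos _), ← mul_assoc]
      refine mul_le_mul_of_nonneg_right ?_ (Real.exp_pos _).le
      have h2 : |F q.1 ^ 2 * b ‖q.1‖ * inner ℝ q.1 (gradient V (q.1 - q.2))| ≤
          M₁ * ‖gradient V (q.1 - q.2)‖ := by
        rw [← real_inner_smul_left]
        exact (abs_real_inner_le_norm _ _).trans
          (mul_le_mul_of_nonneg_right (hM₁ q.1) (norm_nonneg _))
      have h3 : |F q.1 ^ 2 * Ψ ‖q.1‖| ≤ M₂ := hM₂ q.1
      refine (abs_sub _ _).trans ?_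
      nlinarith [norm_nonneg (gradient V (q.1 - q.2))]
  refine lintegral_le_of_forall_fiber hVc hfin h1 hF hFs hφ hpos hKint (fun z => ?_) fun x => ?_
  · have heC : ContDiff ℝ 1 fun x => Real.exp (-V (x - z)) :=
      (hV.comp (contDiff_id.sub contDiff_const)).neg.exp
    have hde : ∀ x, fderiv ℝ (fun x => Real.exp (-V (x - z))) x x =
        -(inner ℝ x (gradient V (x - z)) * Real.exp (-V (x - z))) := by
      intro x
      have h2 : HasFDerivAt (fun x => V (x - z)) (fderiv ℝ V (x - z)) x :=
        (hV.differentiable one_ne_zero (x - z)).hasFDerivAt.comp x ((hasFDerivAt_id x).sub_const z)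
      have h3 : HasFDerivAt (fun x => Real.exp (-V (x - z)))
          (Real.exp (-V (x - z)) • -fderiv ℝ V (x - z)) x := h2.neg.exp
      rw [h3.fderiv, inner_gradient_eq_fderiv]
      simp only [smul_apply, neg_apply, smul_eq_mul]
      ring
    have hmain := neg_integral_radial_le hR₀.le hRR hb' hb'c hΨc
      (fun r hr => by rw [finrank_euclideanSpace_fin]; exact hric r hr) hF hFs hF0 heC fun x => (Real.exp_pos _).le
    simp only [hde] at hmain
    have hi₁ : Integrable fun x => F x ^ 2 * b ‖x‖ *
        (inner ℝ x (gradient V (x - z)) * Real.exp (-V (x - z))) :=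
      (hBc.mul (by fun_prop)).integrable_of_hasCompactSupport hF2s.mul_right.mul_right
    have hi₂ : Integrable fun x => F x ^ 2 * Ψ ‖x‖ * Real.exp (-V (x - z)) :=
      (hPc.mul (by fun_prop)).integrable_of_hasCompactSupport hF2s.mul_right.mul_right
    have hi₃ : Integrable fun x => ‖fderiv ℝ F x‖ ^ 2 * Real.exp (-V (x - z)) := by
      refine Continuous.integrable_of_hasCompactSupport (by fun_prop) (HasCompactSupport.mul_right ?_)
      exact (hFs.fderiv (𝕜 := ℝ)).norm.comp_left (g := fun t : ℝ => t ^ 2) (by simp)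
    simp only [mul_neg, integral_neg, neg_neg, add_mul] at hmain
    rw [integral_add hi₃ hi₂] at hmain
    simp only [sub_mul, mul_assoc] at hmain hi₁ hi₂ ⊢
    rw [integral_sub hi₁ hi₂]
    linarith
  · rcases le_or_gt ‖x‖ (R₀ + 1) with hx | hx
    · simp [hF0 x hx]
    have hxR : R₀ ≤ ‖x‖ := by linarith
    have hx0 : 0 < ‖x‖ := by linarith
    have hP := pSigma_pos (d := d) (σ := σ) (ψ := ψ) hR₀ hxR
    have hp := convDensity_pos hVc (hfin x)
    have hi₁ : Integrable (fun z => inner ℝ x (gradient V (x - z)) * Real.exp (-V (x - z))) ν := by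
      refine integrable_of_locallyBoundedMix (x := x) hb (by fun_prop) (norm_nonneg x) fun z => ?_
      rw [abs_mul, abs_of_pos (Real.exp_pos _), ← mul_assoc]
      exact mul_le_mul_of_nonneg_right (abs_real_inner_le_norm _ _) (Real.exp_pos _).le
    have hK : ∫ z, (F x ^ 2 * b ‖x‖ * inner ℝ x (gradient V (x - z)) - F x ^ 2 * Ψ ‖x‖) *
        Real.exp (-V (x - z)) ∂ν =
        F x ^ 2 * (b ‖x‖ * ‖x‖ * radialDrift V ν x - Ψ ‖x‖) * convDensity V ν x := by
      have h2 := radialDrift_mul hV hb (norm_pos_iff.1 hx0)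
      simp only [sub_mul]
      rw [integral_sub ((hi₁.const_mul (F x ^ 2 * b ‖x‖)).congr (.of_forall fun z => by ring))
        ((integrable_exp_neg_sub hVc (hfin x)).const_mul _), integral_const_mul]
      simp only [mul_assoc (F x ^ 2 * b ‖x‖)]
      rw [integral_const_mul, ← h2, convDensity]
      ring
    rw [hK, mul_comm (φ x)]
    refine mul_le_mul_of_nonneg_right (mul_le_mul_of_nonneg_left ?_ (sq_nonneg _)) hp.le
    rw [hφeq x hxR]
    have h3 : b ‖x‖ * ‖x‖ = (pSigma d R₀ σ ψ ‖x‖)⁻¹ := by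
      simp only [hbdef]
      field_simp
    -- As 1 - σ/(σ+1) = 1/(1+σ), what remains is ψ ≤ h.
    have h4 : radialDrift V ν x / ((1 + σ) * pSigma d R₀ σ ψ ‖x‖) =
        (pSigma d R₀ σ ψ ‖x‖)⁻¹ * (radialDrift V ν x - σ / (σ + 1) * radialDrift V ν x) := by
      field_simp
      ring
    have h5 : Ψ ‖x‖ = (pSigma d R₀ σ ψ ‖x‖)⁻¹ * (σ / (σ + 1) * ψ ‖x‖) := by
      simp only [hΨdef]
      ring
    rw [h3, h4, h5, ← mul_sub]
    have := hψle x hxR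
    gcongr

theorem exists_weakPoincareBeta_of_radialDrift [IsProbabilityMeasure (gibbs V)]
    [IsProbabilityMeasure ν] {R₀ : ℝ} (hR₀ : 0 < R₀) (hV : ContDiff ℝ 1 V)
    (hb : LocallyBoundedMix V ν fun y => ‖gradient V y‖)
    (hh : ContinuousOn (radialDrift V ν) {x | R₀ ≤ ‖x‖})
    (hmin : ∀ s : ℝ, R₀ ≤ s → 0 < minDrift V ν s) {σ : ℝ} (hσ : 0 < σ) :
    ∃ φ : EuclideanSpace ℝ (Fin d) → ℝ, Continuous φ ∧ (∀ x, 0 < φ x) ∧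
      (∀ x, R₀ ≤ ‖x‖ →
        φ x = radialDrift V ν x / ((1 + σ) * pSigma d R₀ σ (minDrift V ν) ‖x‖)) ∧
      WeakPoincareBeta (gibbs V) ν φ := by
  obtain ⟨ψ, hψ, hψeq⟩ := exists_continuous_eqOn_sInf_sphere hR₀ hh
  have hψle : ∀ x, R₀ ≤ ‖x‖ → ψ ‖x‖ ≤ radialDrift V ν x := fun x hx =>
    (hψeq hx).trans_le (sInf_image_sphere_le hh hx)
  have hpS : ∀ x : EuclideanSpace ℝ (Fin d), R₀ ≤ ‖x‖ →
      pSigma d R₀ σ ψ ‖x‖ = pSigma d R₀ σ (minDrift V ν) ‖x‖ := fun x hx => pSigma_congr hψeq hx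
  have hc : ContinuousOn (fun x => radialDrift V ν x / ((1 + σ) * pSigma d R₀ σ ψ ‖x‖))
      {x | R₀ ≤ ‖x‖} := by
    refine hh.div (continuousOn_const.mul ((continuousOn_pSigma hψ hR₀).comp
      continuous_norm.continuousOn fun x hx => hR₀.trans_le hx)) fun x hx => ?_
    have := pSigma_pos (d := d) (σ := σ) (ψ := ψ) hR₀ hx
    positivity
  obtain ⟨φ, hφ, hpos, hφeq⟩ := exists_continuous_pos_eqOn (isClosed_le_norm R₀) hc fun x hx => by
    have h1 := pSigma_pos (d := d) (σ := σ) (ψ := ψ) hR₀ hx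
    have h2 : 0 < radialDrift V ν x :=
      (hmin _ hx).trans_le (sInf_image_sphere_le hh hx)
    positivity
  refine ⟨φ, hφ, hpos, fun x hx => (hφeq hx).trans (by simp only [hpS x hx]), ?_⟩
  exact weakPoincareBeta_of_lyapunov hV hb hφ hpos (R := R₀ + 1) (by linarith)
    fun F hF hFs hF0 => lyapunov_of_radialDrift hV hb hR₀ hσ hψ hψle hφ hpos (fun x hx => hφeq hx)
      hF hFs hF0

/-! ### Part (b): the Laplacian criterion -/

section Laplacian

variable {E : Type*} [NormedAddCommGroup E] [InnerProductSpace ℝ E] [FiniteDimensional ℝ E]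

theorem laplacian_eq_sum_fderiv {U : E → ℝ} (hU : ContDiff ℝ 2 U) (x : E) :
    (Δ U) x = ∑ i, fderiv ℝ (fun y => fderiv ℝ U y (stdOrthonormalBasis ℝ E i)) x
      (stdOrthonormalBasis ℝ E i) := by
  rw [InnerProductSpace.laplacian_eq_iteratedFDeriv_stdOrthonormalBasis]
  refine Finset.sum_congr rfl fun i _ => ?_
  have hd : DifferentiableAt ℝ (fderiv ℝ U) x :=
    (hU.fderiv_right (m := 1) (by norm_num)).differentiable one_ne_zero x
  rw [iteratedFDeriv_two_apply, fderiv_clm_apply hd (differentiableAt_const _)]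
  simp

theorem contDiff_fderiv_apply {E : Type*} [NormedAddCommGroup E] [NormedSpace ℝ E] {U : E → ℝ} (hU : ContDiff ℝ 2 U) (v : E) :
    ContDiff ℝ 1 fun y => fderiv ℝ U y v :=
  (hU.fderiv_right (m := 1) (by norm_num)).clm_apply contDiff_const

theorem continuous_laplacian {U : E → ℝ} (hU : ContDiff ℝ 2 U) : Continuous (Δ U) := by
  rw [funext (laplacian_eq_sum_fderiv hU)]
  exact continuous_finsetSum _ fun i _ =>
    ((contDiff_fderiv_apply hU _).continuous_fderiv one_ne_zero).clm_apply continuous_const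

variable [MeasurableSpace E] [BorelSpace E]

theorem integral_mul_laplacian {k U : E → ℝ} (hk : ContDiff ℝ 1 k) (hks : HasCompactSupport k)
    (hU : ContDiff ℝ 2 U) :
    ∫ x, k x * (Δ U) x = -∫ x, inner ℝ (gradient k x) (gradient U x) := by
  set b := stdOrthonormalBasis ℝ E with hb
  have hk' := hk.continuous_fderiv one_ne_zero
  have hkc := hk.continuous
  have hUi : ∀ i, Continuous fun x => fderiv ℝ U x (b i) :=
    fun i => (contDiff_fderiv_apply hU (b i)).continuous
  have hUii : ∀ i, Continuous fun x => fderiv ℝ (fun y => fderiv ℝ U y (b i)) x (b i) :=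
    fun i => ((contDiff_fderiv_apply hU _).continuous_fderiv one_ne_zero).clm_apply
      continuous_const
  have hks' : ∀ i, HasCompactSupport fun x => fderiv ℝ k x (b i) :=
    fun i => hks.fderiv_apply (𝕜 := ℝ) (b i)
  have h1 : ∀ i, Integrable fun x => k x * fderiv ℝ (fun y => fderiv ℝ U y (b i)) x (b i) :=
    fun i => (hkc.mul (hUii i)).integrable_of_hasCompactSupport hks.mul_right
  have h2 : ∀ i, Integrable fun x => fderiv ℝ k x (b i) * fderiv ℝ U x (b i) :=
    fun i => ((hk'.clm_apply continuous_const).mul (hUi i)).integrable_of_hasCompactSupport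
      (hks' i).mul_right
  have hL : ∀ x, k x * (Δ U) x =
      ∑ i, k x * fderiv ℝ (fun y => fderiv ℝ U y (b i)) x (b i) := fun x => by
    rw [laplacian_eq_sum_fderiv hU, Finset.mul_sum]
  have hI : ∀ x, inner ℝ (gradient k x) (gradient U x) =
      ∑ i, fderiv ℝ k x (b i) * fderiv ℝ U x (b i) := fun x => by
    rw [← b.sum_inner_mul_inner]
    refine Finset.sum_congr rfl fun i _ => ?_
    rw [real_inner_comm, inner_gradient_eq_fderiv, inner_gradient_eq_fderiv]
  simp_rw [hL, hI]
  rw [integral_finsetSum _ fun i _ => h1 i, integral_finsetSum _ fun i _ => h2 i,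
    ← Finset.sum_neg_distrib]
  refine Finset.sum_congr rfl fun i _ => ?_
  refine integral_mul_fderiv_eq_neg_fderiv_mul_of_integrable (h2 i) (h1 i) ?_ ?_ ?_
  · exact (hkc.mul (hUi i)).integrable_of_hasCompactSupport hks.mul_right
  · exact fun x _ => hk.differentiable one_ne_zero x
  · exact fun x _ => (contDiff_fderiv_apply hU (b i)).differentiable one_ne_zero x

/-- Integrating ΔU by parts against F²e^{-U} turns the integrand into 2(1-δ)F∇F·∇U - (1-δ)²F²|∇U|²,
times e^{-U}. Completing the square bounds this by |∇F|²e^{-U}. F need not vanish near the origin.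
-/
theorem integral_sq_mul_lyapunov_le {U F : E → ℝ} (hU : ContDiff ℝ 2 U) (hF : ContDiff ℝ 1 F)
    (hFs : HasCompactSupport F) {δ : ℝ} (hδ : δ < 1) :
    ∫ x, (1 - δ) * F x ^ 2 * (δ * ‖gradient U x‖ ^ 2 - (Δ U) x) * Real.exp (-U x) ≤
      ∫ x, ‖fderiv ℝ F x‖ ^ 2 * Real.exp (-U x) := by
  have hU1 : ContDiff ℝ 1 U := hU.of_le (by norm_num)
  have hUc := hU.continuous
  have hFc := hF.continuous
  have hUg := continuous_gradient hU1
  have hFg := continuous_gradient hF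
  have hUl := continuous_laplacian hU
  have hF'c := hF.continuous_fderiv one_ne_zero
  set k : E → ℝ := fun x => F x ^ 2 * Real.exp (-U x) with hk
  have hF2s : HasCompactSupport fun x => F x ^ 2 :=
    hFs.comp_left (g := fun t : ℝ => t ^ 2) (by simp)
  have hks : HasCompactSupport k := hF2s.mul_right
  have hkC : ContDiff ℝ 1 k := (hF.pow 2).mul hU1.neg.exp
  have hkg : ∀ x, inner ℝ (gradient k x) (gradient U x) =
      (2 * F x * inner ℝ (gradient F x) (gradient U x) - F x ^ 2 * ‖gradient U x‖ ^ 2) *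
        Real.exp (-U x) := by
    intro x
    have h1 : HasFDerivAt (fun y => F y ^ 2) ((2 * F x) • fderiv ℝ F x) x := by
      simpa using (hF.differentiable one_ne_zero x).hasFDerivAt.pow 2
    have h2 : HasFDerivAt (fun y => Real.exp (-U y)) (Real.exp (-U x) • -fderiv ℝ U x) x :=
      (hU1.differentiable one_ne_zero x).hasFDerivAt.neg.exp
    have h3 : HasFDerivAt k (F x ^ 2 • Real.exp (-U x) • -fderiv ℝ U x +
        Real.exp (-U x) • (2 * F x) • fderiv ℝ F x) x := h1.mul h2
    rw [real_inner_comm, inner_gradient_eq_fderiv, h3.fderiv]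
    simp only [add_apply, smul_apply, neg_apply, smul_eq_mul, ← inner_gradient_eq_fderiv,
      real_inner_self_eq_norm_sq]
    rw [real_inner_comm]
    ring
  have hlap := integral_mul_laplacian hkC hks hU
  simp only [hkg] at hlap
  have hi₁ : Integrable fun x => δ * ‖gradient U x‖ ^ 2 * k x :=
    Continuous.integrable_of_hasCompactSupport (by fun_prop) hks.mul_left
  have hi₂ : Integrable fun x => k x * (Δ U) x :=
    Continuous.integrable_of_hasCompactSupport (by fun_prop) hks.mul_right
  have hi₃ : Integrable fun x =>
      (2 * F x * inner ℝ (gradient F x) (gradient U x) - F x ^ 2 * ‖gradient U x‖ ^ 2) *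
        Real.exp (-U x) := by
    refine Continuous.integrable_of_hasCompactSupport (by fun_prop) (HasCompactSupport.mul_right ?_)
    exact hFs.mono fun x hx => by
      contrapose! hx
      simp only [Function.mem_support, not_not] at hx
      simp [hx]
  have hi₄ : Integrable fun x => ‖fderiv ℝ F x‖ ^ 2 * Real.exp (-U x) := by
    refine Continuous.integrable_of_hasCompactSupport (by fun_prop) (HasCompactSupport.mul_right ?_)
    exact (hFs.fderiv (𝕜 := ℝ)).norm.comp_left (g := fun t : ℝ => t ^ 2) (by simp)
  have hLHS : ∀ x, (1 - δ) * F x ^ 2 * (δ * ‖gradient U x‖ ^ 2 - (Δ U) x) * Real.exp (-U x) =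
      (1 - δ) * (δ * ‖gradient U x‖ ^ 2 * k x - k x * (Δ U) x) := fun x => by
    simp only [hk]; ring
  simp only [hLHS]
  rw [integral_const_mul, integral_sub hi₁ hi₂, hlap, sub_neg_eq_add, ← integral_add hi₁ hi₃,
    ← integral_const_mul]
  refine integral_mono ((hi₁.add hi₃).const_mul _) hi₄ fun x => ?_
  have hcs : inner ℝ (gradient F x) (gradient U x) * F x ≤
      ‖fderiv ℝ F x‖ * (|F x| * ‖gradient U x‖) := by
    rw [← norm_gradient_eq_norm_fderiv]
    refine (le_abs_self _).trans ?_
    rw [abs_mul]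
    calc _ ≤ ‖gradient F x‖ * ‖gradient U x‖ * |F x| := by
          gcongr; exact abs_real_inner_le_norm _ _
      _ = _ := by ring
  have hsq : (|F x| * ‖gradient U x‖) ^ 2 = F x ^ 2 * ‖gradient U x‖ ^ 2 := by
    rw [mul_pow, sq_abs]
  have hpt : (1 - δ) * (δ * ‖gradient U x‖ ^ 2 * F x ^ 2 +
      (2 * F x * inner ℝ (gradient F x) (gradient U x) - F x ^ 2 * ‖gradient U x‖ ^ 2)) ≤
      ‖fderiv ℝ F x‖ ^ 2 := by
    have h1 : (1 - δ) * (δ * ‖gradient U x‖ ^ 2 * F x ^ 2 +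
        (2 * F x * inner ℝ (gradient F x) (gradient U x) - F x ^ 2 * ‖gradient U x‖ ^ 2)) =
        2 * ((1 - δ) * (inner ℝ (gradient F x) (gradient U x) * F x)) -
          ((1 - δ) * (|F x| * ‖gradient U x‖)) ^ 2 := by
      rw [mul_pow (1 - δ), hsq]; ring
    rw [h1]
    nlinarith [sq_nonneg ((1 - δ) * (|F x| * ‖gradient U x‖) - ‖fderiv ℝ F x‖),
      mul_le_mul_of_nonneg_left hcs (sub_nonneg.2 hδ.le)]
  calc _ = (1 - δ) * (δ * ‖gradient U x‖ ^ 2 * F x ^ 2 +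
      (2 * F x * inner ℝ (gradient F x) (gradient U x) - F x ^ 2 * ‖gradient U x‖ ^ 2)) *
        Real.exp (-U x) := by simp only [hk]; ring
    _ ≤ _ := mul_le_mul_of_nonneg_right hpt (Real.exp_pos _).le

end Laplacian

theorem lyapunov_of_lyapunovIntegral [IsProbabilityMeasure (gibbs V)] [IsProbabilityMeasure ν]
    (hV : ContDiff ℝ 2 V)
    (hb : LocallyBoundedMix V ν fun y => ‖gradient V y‖ + ‖gradient V y‖ ^ 2 + |(Δ V) y|)
    {δ R : ℝ} (hδ0 : 0 < δ) (hδ1 : δ < 1)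
    {φ : EuclideanSpace ℝ (Fin d) → ℝ} (hφ : Continuous φ) (hpos : ∀ x, 0 < φ x)
    (hφeq : ∀ x, R ≤ ‖x‖ → φ x = (1 - δ) * lyapunovIntegral δ V ν x)
    {F : EuclideanSpace ℝ (Fin d) → ℝ} (hF : ContDiff ℝ 1 F) (hFs : HasCompactSupport F)
    (hF0 : ∀ x, ‖x‖ ≤ R → F x = 0) :
    ∫⁻ x, ENNReal.ofReal (φ x * F x ^ 2) ∂(volume.withDensity (convLDensity V ν)) ≤
      ∫⁻ x, ENNReal.ofReal (‖fderiv ℝ F x‖ ^ 2) ∂(volume.withDensity (convLDensity V ν)) := by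
  have hV1 : ContDiff ℝ 1 V := hV.of_le (by norm_num)
  have hVc := hV.continuous
  have hVg := continuous_gradient hV1
  have hVl := continuous_laplacian hV
  have hFc := hF.continuous
  have hb1 : LocallyBoundedMix V ν fun y => ‖gradient V y‖ :=
    hb.mono fun x => by nlinarith [abs_nonneg ((Δ V) x), sq_nonneg ‖gradient V x‖]
  have hfin := convLDensity_lt_top hV1 hb1
  have h1 := locallyBoundedMix_const_one (exists_convLDensity_le hV1 hb1)
  have hF2s : HasCompactSupport fun x => F x ^ 2 :=
    hFs.comp_left (g := fun t : ℝ => t ^ 2) (by simp)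
  obtain ⟨M, hM⟩ := (hFc.pow 2).bounded_above_of_compact_support hF2s
  have hM0 : 0 ≤ M := (norm_nonneg _).trans (hM 0)
  obtain ⟨R', hR'⟩ := hFs.isCompact.isBounded.subset_closedBall 0
  have hFR : ∀ x, R' < ‖x‖ → F x = 0 := by
    refine fun x hx => image_eq_zero_of_notMem_tsupport fun h => ?_
    have := hR' h
    rw [mem_closedBall_zero_iff] at this
    linarith
  have hKint : Integrable (fun q : EuclideanSpace ℝ (Fin d) × EuclideanSpace ℝ (Fin d) =>
      (1 - δ) * F q.1 ^ 2 * (δ * ‖gradient V (q.1 - q.2)‖ ^ 2 - (Δ V) (q.1 - q.2)) *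
        Real.exp (-V (q.1 - q.2))) (volume.prod ν) := by
    refine integrable_prod_of_locallyBoundedMix hb (by fun_prop) (M := M) (R := R') hM0
      (fun q => ?_) fun q hq => by simp [hFR _ hq]
    rw [abs_mul, abs_of_pos (Real.exp_pos _), ← mul_assoc, abs_mul]
    refine mul_le_mul_of_nonneg_right (mul_le_mul ?_ ?_ (abs_nonneg _) hM0) (Real.exp_pos _).le
    · have h2 : F q.1 ^ 2 ≤ M := (le_abs_self _).trans (hM q.1)
      rw [abs_of_nonneg (mul_nonneg (by linarith) (sq_nonneg _))]
      nlinarith [sq_nonneg (F q.1)]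
    · refine (abs_sub _ _).trans (add_le_add ?_ le_rfl)
      rw [abs_of_nonneg (by positivity)]
      nlinarith [norm_nonneg (gradient V (q.1 - q.2)), sq_nonneg ‖gradient V (q.1 - q.2)‖]
  refine lintegral_le_of_forall_fiber hVc hfin h1 hF hFs hφ hpos hKint (fun z => ?_) fun x => ?_
  -- Translating by z moves the shift from V to F, so the estimate applies with U = V.
  · have hFz : ContDiff ℝ 1 fun x => F (x + z) := hF.comp (contDiff_id.add contDiff_const)
    have hFzs : HasCompactSupport fun x => F (x + z) :=
      hFs.comp_homeomorph (Homeomorph.addRight z)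
    have hmain := integral_sq_mul_lyapunov_le hV hFz hFzs hδ1
    rw [← integral_add_right_eq_self _ z, ← integral_add_right_eq_self
      (fun x => ‖fderiv ℝ F x‖ ^ 2 * Real.exp (-V (x - z))) z]
    simpa [fderiv_comp_add_right] using hmain
  · rcases le_or_gt ‖x‖ R with hx | hx
    · simp [hF0 x hx]
    have hp := convDensity_pos hVc (hfin x)
    rw [hφeq x hx.le, lyapunovIntegral, integral_tiltedNu hVc (hfin x)]
    simp only [mul_assoc]
    rw [integral_const_mul, integral_const_mul]
    field_simp
    rfl

theorem exists_weakPoincareBeta_of_lyapunovIntegral [IsProbabilityMeasure (gibbs V)]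
    [IsProbabilityMeasure ν] {δ R₀ : ℝ} (hδ0 : 0 < δ) (hδ1 : δ < 1) (hR₀ : 0 < R₀)
    (hV : ContDiff ℝ 2 V)
    (hb : LocallyBoundedMix V ν fun y => ‖gradient V y‖ + ‖gradient V y‖ ^ 2 + |(Δ V) y|)
    (hg : ContinuousOn (lyapunovIntegral δ V ν) {x | R₀ ≤ ‖x‖})
    (hg0 : ∀ x, R₀ ≤ ‖x‖ → 0 < lyapunovIntegral δ V ν x) :
    ∃ φ : EuclideanSpace ℝ (Fin d) → ℝ, Continuous φ ∧ (∀ x, 0 < φ x) ∧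
      (∀ x, R₀ ≤ ‖x‖ → φ x = (1 - δ) * lyapunovIntegral δ V ν x) ∧
      WeakPoincareBeta (gibbs V) ν φ := by
  obtain ⟨φ, hφ, hpos, hφeq⟩ := exists_continuous_pos_eqOn (isClosed_le_norm R₀)
    (hg.const_mul (1 - δ)) fun x hx => mul_pos (sub_pos.2 hδ1) (hg0 x hx)
  have hb1 : LocallyBoundedMix V ν fun y => ‖gradient V y‖ :=
    hb.mono fun x => by nlinarith [abs_nonneg ((Δ V) x), sq_nonneg ‖gradient V x‖]
  refine ⟨φ, hφ, hpos, fun x hx => hφeq hx, ?_⟩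
  exact weakPoincareBeta_of_lyapunov (hV.of_le (by norm_num)) hb1 hφ hpos hR₀ fun F hF hFs hF0 =>
    lyapunov_of_lyapunovIntegral hV hb hδ0 hδ1 hφ hpos (fun x hx => hφeq hx) hF hFs hF0

end Main

end

theorem theorem1p1 (d : ℕ) (hd : 1 ≤ d) (V : EuclideanSpace ℝ (Fin d) → ℝ)
    (ν : Measure (EuclideanSpace ℝ (Fin d))) [IsProbabilityMeasure (gibbs V)]
    [IsProbabilityMeasure ν] :
    (∀ R₀ : ℝ, 0 < R₀ → ContDiff ℝ 1 V →
      LocallyBoundedMix V ν (fun y => ‖gradient V y‖) →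
      ContinuousOn (radialDrift V ν) {x | R₀ ≤ ‖x‖} →
      (∀ s : ℝ, R₀ ≤ s → 0 < minDrift V ν s) →
      ∀ σ : ℝ, 0 < σ →
        ∃ φ : EuclideanSpace ℝ (Fin d) → ℝ, Continuous φ ∧ (∀ x, 0 < φ x) ∧
          (∀ x, R₀ ≤ ‖x‖ →
            φ x = radialDrift V ν x / ((1 + σ) * pSigma d R₀ σ (minDrift V ν) ‖x‖)) ∧
          WeakPoincareBeta (gibbs V) ν φ) ∧
    (∀ δ R₀ : ℝ, 0 < δ → δ < 1 → 0 < R₀ → ContDiff ℝ 2 V →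
      LocallyBoundedMix V ν (fun y => ‖gradient V y‖ + ‖gradient V y‖ ^ 2 + |(Δ V) y|) →
      ContinuousOn (lyapunovIntegral δ V ν) {x | R₀ ≤ ‖x‖} →
      (∀ x, R₀ ≤ ‖x‖ → 0 < lyapunovIntegral δ V ν x) →
        ∃ φ : EuclideanSpace ℝ (Fin d) → ℝ, Continuous φ ∧ (∀ x, 0 < φ x) ∧
          (∀ x, R₀ ≤ ‖x‖ → φ x = (1 - δ) * lyapunovIntegral δ V ν x) ∧
          WeakPoincareBeta (gibbs V) ν φ) := by
  exact ⟨fun R₀ hR₀ hV hb hh hmin σ hσ =>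
      exists_weakPoincareBeta_of_radialDrift hR₀ hV hb hh hmin hσ,
    fun δ R₀ hδ0 hδ1 hR₀ hV hb hg hg0 =>
      exists_weakPoincareBeta_of_lyapunovIntegral hδ0 hδ1 hR₀ hV hb hg hg0⟩
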